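/- Let $\log$ denote the principal branch of the logarithm on $\mathbb{C}\setminus(-\infty,0]$, and let $\ln\Gamma$ denote the analytic function on $\mathbb{C}\setminus(-\infty,0]$ with $\ln\Gamma(x)=\log(\Gamma(x))$ real for real $x>0$. For integers $j\ge 1$ and complex $z\ne 0$ put $$T_j(z)=\frac{B_{2j}}{2j(2j-1)z^{2j-1}},\qquad \widehat{T}_j(z)=T_j(2z)-T_j(z),$$ where $B_{2j}$ is a Bernoulli number. For integers $k\ge 1$ put $\eta_k=1/(1-2^{1-2k})$ and, for $z\neq 0$ with $\operatorname{Re} z\ge 0$, define $\widehat{R}_k(z)$ by $$\ln\Gamma\left(z+\tfrac12\right)=z\log z-z+\tfrac12\log(2\pi)+\sum_{j=1}^{k-1}\widehat{T}_j(z)+\widehat{R}_k(z).$$ Theorem. Let $k\ge 1$ be an integer and let $z\in\mathbb{C}$, $z\ne 0$, with $\operatorname{Re} z\ge 0$ and $k\le|z|$. Then $$\left|\frac{\widehat{R}_{k+1}(z)}{\widehat{T}_k(z)}\right|<\eta_k\,\frac{(k/|z|)^2}{\pi^2-1} \qquad\text{and}\qquad \left|\frac{\widehat{R}_{k}(z)}{\widehat{T}_k(z)}\right|<1+\eta_k\,\frac{(k/|z|)^2}{\pi^2-1}.$$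 -/

import Mathlib

namespace StirlingHalf

open Filter Topology

/-- The general term of the Weierstrass series of `ln Γ`. -/
noncomputable def logGammaTerm (n : ℕ) (z : ℂ) : ℂ :=
  z / ((n : ℂ) + 1) - Complex.log (1 + z / ((n : ℂ) + 1))

/-- The principal branch of `ln Γ` on the cut plane `ℂ \ (-∞, 0]`, as the Weierstrass series
`-γ z - log z + ∑_{n ≥ 1} (z / n - log (1 + z / n))`, where `log` is the principal branch.
The two theorems `differentiableOn_logGamma` and `logGamma_ofReal` below show that it is the
(by the identity theorem, unique) analytic function on the cut plane which agrees with
`log (Γ x)` at every positive real `x`. -/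
noncomputable def logGamma (z : ℂ) : ℂ :=
  -(Real.eulerMascheroniConstant : ℂ) * z - Complex.log z + ∑' n : ℕ, logGammaTerm n z

theorem one_add_div_mem_slitPlane {z : ℂ} (hz : z ∈ Complex.slitPlane) (n : ℕ) :
    1 + z / ((n : ℂ) + 1) ∈ Complex.slitPlane := by
  have hn : (0 : ℝ) < (n : ℝ) + 1 := by positivity
  have hcast : ((n : ℂ) + 1) = (((n : ℝ) + 1 : ℝ) : ℂ) := by push_cast; rfl
  rw [hcast, Complex.mem_slitPlane_iff]
  rw [Complex.mem_slitPlane_iff] at hz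
  simp only [Complex.add_re, Complex.add_im, Complex.one_re, Complex.one_im,
    Complex.div_ofReal_re, Complex.div_ofReal_im, zero_add]
  rcases hz with h | h
  · left; positivity
  · right; exact div_ne_zero h hn.ne'

theorem norm_logGammaTerm_le {N n : ℕ} {z : ℂ} (hz : ‖z‖ < N) (hn : 2 * N ≤ n) :
    ‖logGammaTerm n z‖ ≤ (N : ℝ) ^ 2 * (1 / ((n : ℝ) + 1) ^ 2) := by
  have hn' : (2 : ℝ) * N ≤ n := by exact_mod_cast hn
  have hN : (0 : ℝ) ≤ N := by positivity
  have hpos : (0 : ℝ) < (n : ℝ) + 1 := by positivity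
  have hw : ‖z / ((n : ℂ) + 1)‖ = ‖z‖ / ((n : ℝ) + 1) := by
    rw [norm_div]
    congr 1
    exact_mod_cast Complex.norm_natCast (n + 1)
  have hhalf : ‖z / ((n : ℂ) + 1)‖ ≤ 1 / 2 := by
    rw [hw, div_le_iff₀ hpos]; linarith
  have h1 := Complex.norm_log_one_add_sub_self_le (z := z / ((n : ℂ) + 1)) (by linarith)
  have hinv : (1 - ‖z / ((n : ℂ) + 1)‖)⁻¹ ≤ 2 := by
    rw [inv_le_comm₀ (by linarith) (by norm_num)]; linarith
  have hsq : ‖z / ((n : ℂ) + 1)‖ ^ 2 ≤ (N : ℝ) ^ 2 * (1 / ((n : ℝ) + 1) ^ 2) := by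
    rw [hw, div_pow, mul_one_div]
    gcongr
  unfold logGammaTerm
  rw [norm_sub_rev]
  refine h1.trans (le_trans ?_ hsq)
  have := mul_le_mul_of_nonneg_left hinv (sq_nonneg ‖z / ((n : ℂ) + 1)‖)
  linarith

theorem summable_sq_bound (N : ℕ) :
    Summable fun n : ℕ => (N : ℝ) ^ 2 * (1 / ((n : ℝ) + 1) ^ 2) := by
  have h := (summable_nat_add_iff 1).mpr (Real.summable_one_div_nat_pow.mpr one_lt_two)
  simpa using h.mul_left ((N : ℝ) ^ 2)

theorem summable_logGammaTerm (z : ℂ) : Summable fun n : ℕ => logGammaTerm n z := by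
  obtain ⟨N, hN⟩ := exists_nat_gt ‖z‖
  exact Summable.of_norm_bounded_eventually_nat (summable_sq_bound N)
    ((eventually_ge_atTop (2 * N)).mono fun n hn => norm_logGammaTerm_le hN hn)

theorem differentiableOn_logGammaTerm (n : ℕ) :
    DifferentiableOn ℂ (logGammaTerm n) Complex.slitPlane := by
  intro z hz
  unfold logGammaTerm
  have hd : DifferentiableAt ℂ (fun z : ℂ => z / ((n : ℂ) + 1)) z := by fun_prop
  exact (hd.sub ((hd.const_add 1).clog (one_add_div_mem_slitPlane hz n))).differentiableWithinAt

/-- `logGamma` is analytic on the cut plane. -/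
theorem differentiableOn_logGamma : DifferentiableOn ℂ logGamma Complex.slitPlane := by
  intro z hz
  obtain ⟨N, hN⟩ := exists_nat_gt ‖z‖
  have hopen : IsOpen (Complex.slitPlane ∩ Metric.ball (0 : ℂ) N) :=
    Complex.isOpen_slitPlane.inter Metric.isOpen_ball
  have hmem : z ∈ Complex.slitPlane ∩ Metric.ball (0 : ℂ) N := ⟨hz, by simpa using hN⟩
  have htail : DifferentiableOn ℂ (fun w : ℂ => ∑' n : ℕ, logGammaTerm (n + 2 * N) w)
      (Complex.slitPlane ∩ Metric.ball (0 : ℂ) N) := by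
    refine Complex.differentiableOn_tsum_of_summable_norm
      ((summable_nat_add_iff (2 * N)).mpr (summable_sq_bound N))
      (fun n => (differentiableOn_logGammaTerm _).mono Set.inter_subset_left) hopen ?_
    intro n w hw
    exact norm_logGammaTerm_le (by simpa using hw.2) (by omega)
  have hsplit : logGamma = fun w : ℂ =>
      -(Real.eulerMascheroniConstant : ℂ) * w - Complex.log w +
        (∑ n ∈ Finset.range (2 * N), logGammaTerm n w +
          ∑' n : ℕ, logGammaTerm (n + 2 * N) w) := by
    funext w
    rw [logGamma, (summable_logGammaTerm w).sum_add_tsum_nat_add (2 * N)]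
  rw [hsplit]
  have hfin : DifferentiableAt ℂ
      (fun w : ℂ => ∑ n ∈ Finset.range (2 * N), logGammaTerm n w) z := by
    refine DifferentiableAt.fun_sum fun n _ => ?_
    exact (differentiableOn_logGammaTerm n).differentiableAt
      (Complex.isOpen_slitPlane.mem_nhds hz)
  have hlog : DifferentiableAt ℂ
      (fun w : ℂ => -(Real.eulerMascheroniConstant : ℂ) * w - Complex.log w) z :=
    (differentiableAt_id.const_mul _).sub (differentiableAt_id.clog hz)
  exact (hlog.add (hfin.add
    (htail.differentiableAt (hopen.mem_nhds hmem)))).differentiableWithinAt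

/-- `logGamma` agrees with the real logarithm of `Γ` on the positive real axis. -/
theorem logGamma_ofReal {x : ℝ} (hx : 0 < x) :
    logGamma x = (Real.log (Real.Gamma x) : ℂ) := by
  have hterm : ∀ n : ℕ, logGammaTerm n (x : ℂ) =
      ((x / ((n : ℝ) + 1) - Real.log (1 + x / ((n : ℝ) + 1)) : ℝ) : ℂ) := by
    intro n
    rw [logGammaTerm, Complex.ofReal_sub, Complex.ofReal_log (by positivity)]
    push_cast
    rfl
  have hsum : Summable fun n : ℕ => x / ((n : ℝ) + 1) - Real.log (1 + x / ((n : ℝ) + 1)) := by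
    have h := summable_logGammaTerm (x : ℂ)
    simp only [hterm] at h
    exact_mod_cast h
  have hpartial : ∀ n : ℕ,
      ∑ m ∈ Finset.range n, (x / ((m : ℝ) + 1) - Real.log (1 + x / ((m : ℝ) + 1))) =
        Real.BohrMollerup.logGammaSeq x n + x * ((harmonic n : ℝ) - Real.log n)
          + Real.log x := by
    intro n
    have key : ∑ m ∈ Finset.range n, (x / ((m : ℝ) + 1) - Real.log (1 + x / ((m : ℝ) + 1))) =
        x * (harmonic n : ℝ) + Real.log (n.factorial : ℝ)
          - ∑ m ∈ Finset.range n, Real.log (x + ((m : ℝ) + 1)) := by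
      induction n with
      | zero => simp
      | succ k ih =>
        have hk : (0 : ℝ) < (k : ℝ) + 1 := by positivity
        have hf : (0 : ℝ) < (k.factorial : ℝ) := by positivity
        have h1 : 1 + x / ((k : ℝ) + 1) = (x + ((k : ℝ) + 1)) / ((k : ℝ) + 1) := by
          field_simp; ring
        rw [Finset.sum_range_succ, ih, Finset.sum_range_succ, harmonic_succ,
          Nat.factorial_succ, h1, Real.log_div (by positivity) hk.ne']
        push_cast
        rw [Real.log_mul hk.ne' hf.ne']
        ring
    rw [key, Real.BohrMollerup.logGammaSeq, Finset.sum_range_succ']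
    push_cast
    rw [add_zero]
    ring
  have hlim := (((Real.BohrMollerup.tendsto_log_gamma hx).add
    (Real.tendsto_harmonic_sub_log.const_mul x)).add_const (Real.log x))
  have htsum : ∑' n : ℕ, (x / ((n : ℝ) + 1) - Real.log (1 + x / ((n : ℝ) + 1))) =
      Real.log (Real.Gamma x) + x * Real.eulerMascheroniConstant + Real.log x := by
    refine tendsto_nhds_unique hsum.hasSum.tendsto_sum_nat ?_
    simp only [hpartial]
    exact hlim
  rw [logGamma]
  simp only [hterm]
  rw [← Complex.ofReal_tsum, htsum, ← Complex.ofReal_log hx.le]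
  push_cast
  ring

/-- `η_k = 1 / (1 - 2 ^ (1 - 2k))`. -/
noncomputable def eta (k : ℕ) : ℝ := 1 / (1 - (2 : ℝ) ^ (1 - 2 * (k : ℤ)))

/-- The `j`-th term of Stirling's series for `ln Γ(z)`, for `j ≥ 1`:
`T_j(z) = B_{2j} / (2j (2j - 1) z ^ (2j - 1))`. -/
noncomputable def T (j : ℕ) (z : ℂ) : ℂ :=
  (bernoulli (2 * j) : ℂ) / (2 * (j : ℂ) * (2 * (j : ℂ) - 1) * z ^ (2 * j - 1))

/-- The `j`-th term of Gauss's series for `ln Γ(z + 1/2)`, for `j ≥ 1`. -/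
noncomputable def That (j : ℕ) (z : ℂ) : ℂ := T j (2 * z) - T j z

/-- The remainder `R̂_k(z)`, for `k ≥ 1`, defined by
`ln Γ(z + 1/2) = z log z - z + (1/2) log (2π) + ∑_{j=1}^{k-1} T̂_j(z) + R̂_k(z)`. -/
noncomputable def Rhat (k : ℕ) (z : ℂ) : ℂ :=
  logGamma (z + 1 / 2) -
    (z * Complex.log z - z + (1 / 2 : ℂ) * (Real.log (2 * Real.pi) : ℂ) +
      ∑ j ∈ Finset.Ico 1 k, That j z)

end StirlingHalf

/-!
Write `g z = z log z - z`, so that `g' = log`, and let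
`I(ω, m) = ∫_0^∞ cos (ω u) / (u + z) ^ (2 m + 2) du` (`cosIntegral`).

*An integral for the remainder.* The partial sums of the Weierstrass series of `ln Γ (z + 1/2)`,
combined with Stirling's formula for `n!`, give
`R̂_1(z) = ∑_{m ≥ 0} (g (z + m + 1) - g (z + m) - log (z + m + 1/2))`, a sum of errors of the
midpoint rule for `log` (`tendsto_sum_midpointError`). Each error is an integral over a unit
interval against the periodic function `b(u) = ∑ (-1)^n cos (2 π n u) / n²`, which is a quadratic
polynomial on each half of the period. Hence
`R̂_2(z) = -(2 π²)⁻¹ ∫_0^∞ b(u) / (z + u)² du = -(2 π²)⁻¹ ∑ (-1)^n / n² I(2 π n, 0)`.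
Two integrations by parts connect `I(ω, m)` with `I(ω, m + 1)` (`cosIntegral_eq`), and the boundary
terms add up to `T̂_k`, because `T̂_k` is a multiple of `∑ (-1)^n (2 π n)^{-2k}`. By induction
`R̂_{k+1}(z) = (-1)^k 2 (2k-1)! ∑ (-1)^n (2 π n)^{-2k} I(2 π n, k - 1)` (`hasSum_Rhat`).

*Reduction to one frequency.* Since `|T̂_k(z)| = η_k⁻¹ 2 (2k-2)! |z|^{1-2k} ∑ (2 π n)^{-2k}`, the
first inequality follows from the bound
`(2k-1) |z|^{2k-1} |I(ω, k - 1)| < (k/|z|)² / (π² - 1)` for every `ω ≥ 2 π` (`cosIntegral_lt`).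
The second one follows from the first and `R̂_k = T̂_k + R̂_{k+1}`.

*The bound for one frequency.* Let `e_r = (2k+2r-1) |z|^{2k+2r-1} |I(ω, k + r - 1)|`. The
integration by parts gives `e_r ≤ (2k+2r)(2k+2r-1) / (2 π |z|)² (1 + e_{r+1})`, and
`|u + z|² ≥ u² + |z|²`, valid in the closed right half-plane, gives a crude bound for every `e_r`,
linear in `k + r`. With `q_r = (k + r) / (π k)` the sequence `q_r² / (1 - q_r²)` satisfies the
recursive inequality in the reverse direction as long as `5 q_r² + 2 q_r / (π k) ≤ 1`, in
particular for `r ≤ k / 3`, and it is `1 / (π² - 1)` at `r = 0`; the crude bound at `r ≈ k / 3`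
is damped by a factor `1/5` at each step back to `r = 0`. This settles `k ≥ 21`
(`backward_bound_large`); smaller `k` need only two to six steps with explicit numbers
(`backward_bound_small`).
-/

namespace StirlingHalf

open Real Filter Topology MeasureTheory Set

/-! ### The backward recursion for a single frequency -/

/-- The value of `∫_0^∞ (1 + u²)^{-(m+1)} du`, given by its recursion in `m`. -/
noncomputable def halfLineConst : ℕ → ℝ
  | 0 => π / 2
  | m + 1 => (2 * m + 1) / (2 * m + 2) * halfLineConst m

theorem halfLineConst_nonneg (m : ℕ) : 0 ≤ halfLineConst m := by
  induction m with
  | zero => simp only [halfLineConst]; positivity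
  | succ m ih => simp only [halfLineConst]; positivity

theorem halfLineConst_le (m : ℕ) : halfLineConst m ≤ π / 2 := by
  induction m with
  | zero => simp [halfLineConst]
  | succ m ih =>
    refine le_trans ?_ ih
    refine mul_le_of_le_one_left (halfLineConst_nonneg m) ?_
    rw [div_le_one (by positivity)]
    linarith

theorem pi_sq_bounds : (9.8696 : ℝ) < π ^ 2 ∧ π ^ 2 < 9.8697 := by
  have h1 := pi_gt_d6
  have h2 := pi_lt_d6
  constructor <;> nlinarith

/-- The recursion with `π²` replaced by the rational lower bound `9.8696` (so that
`(2 π k)²` becomes `39.4784 k²`), ready to be iterated numerically. -/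
theorem backward_step {k : ℕ} (hk : 1 ≤ k) {e : ℕ → ℝ}
    (hrec : ∀ r, 1 ≤ r → e r ≤
      (2 * k + 2 * r) * (2 * k + 2 * r - 1) / (2 * π * k) ^ 2 * (1 + e (r + 1)))
    (r : ℕ) (hr : 1 ≤ r) (x : ℝ) (hx : 0 ≤ x) (he : e (r + 1) ≤ x) :
    e r ≤ (2 * k + 2 * r) * (2 * k + 2 * r - 1) / (39.4784 * k ^ 2) * (1 + x) := by
  have hk' : (1 : ℝ) ≤ k := by exact_mod_cast hk
  have hr' : (1 : ℝ) ≤ r := by exact_mod_cast hr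
  have hnum : (0 : ℝ) ≤ (2 * k + 2 * r) * (2 * k + 2 * r - 1) :=
    mul_nonneg (by linarith) (by linarith)
  have hden : 39.4784 * (k : ℝ) ^ 2 ≤ (2 * π * k) ^ 2 := by
    have := pi_sq_bounds.1
    have := mul_le_mul_of_nonneg_right this.le (sq_nonneg (k : ℝ))
    nlinarith
  calc e r ≤ (2 * k + 2 * r) * (2 * k + 2 * r - 1) / (2 * π * k) ^ 2 * (1 + e (r + 1)) :=
        hrec r hr
    _ ≤ (2 * k + 2 * r) * (2 * k + 2 * r - 1) / (2 * π * k) ^ 2 * (1 + x) := by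
        gcongr
    _ ≤ _ := by gcongr

/-- For `k ≤ 20`, starting the recursion from the crude bound at `r = 2` (`k = 1`), `r = 4`
(`k = 2, 3`) or `r = 6` (`k ≥ 4`) suffices. -/
theorem backward_bound_small {k : ℕ} (hk : 1 ≤ k) (hk' : k ≤ 20) {e : ℕ → ℝ}
    (hrec : ∀ r, 1 ≤ r → e r ≤
      (2 * k + 2 * r) * (2 * k + 2 * r - 1) / (2 * π * k) ^ 2 * (1 + e (r + 1)))
    (hcrude : ∀ r, e r ≤ (2 * (k + r) - 1) * halfLineConst (k + r - 1)) :
    2 * k * (2 * k - 1) / (2 * π * k) ^ 2 * (1 + e 1) < 1 / (π ^ 2 - 1) := by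
  have hstep := backward_step hk hrec
  have hk1 : (1 : ℝ) ≤ k := by exact_mod_cast hk
  have hpi := pi_lt_d6
  have hfin : ∀ x : ℝ, 0 ≤ x → e 1 ≤ x →
      2 * k * (2 * k - 1) / (39.4784 * k ^ 2) * (1 + x) < 1 / (8.8697 : ℝ) →
      2 * k * (2 * k - 1) / (2 * π * k) ^ 2 * (1 + e 1) < 1 / (π ^ 2 - 1) := by
    intro x hx he hlt
    have hnum : (0 : ℝ) ≤ 2 * k * (2 * k - 1) := mul_nonneg (by linarith) (by linarith)
    have hden : 39.4784 * (k : ℝ) ^ 2 ≤ (2 * π * k) ^ 2 := by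
      have := mul_le_mul_of_nonneg_right pi_sq_bounds.1.le (sq_nonneg (k : ℝ))
      nlinarith
    calc 2 * k * (2 * k - 1) / (2 * π * k) ^ 2 * (1 + e 1)
        ≤ 2 * k * (2 * k - 1) / (2 * π * k) ^ 2 * (1 + x) := by gcongr
      _ ≤ 2 * k * (2 * k - 1) / (39.4784 * k ^ 2) * (1 + x) := by gcongr
      _ < 1 / (8.8697 : ℝ) := hlt
      _ ≤ 1 / (π ^ 2 - 1) := by
        have := pi_sq_bounds
        exact one_div_le_one_div_of_le (by linarith) (by linarith)
  rcases le_or_gt 4 k with h4 | h4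
  · have h6 : e 6 ≤ (2 * k + 11) * 1.5708 :=
      calc e 6 ≤ (2 * (k + 6) - 1) * halfLineConst (k + 6 - 1) := by exact_mod_cast hcrude 6
        _ ≤ (2 * (k + 6) - 1) * (π / 2) := by
          gcongr
          · linarith
          · exact halfLineConst_le _
        _ ≤ (2 * (k + 6) - 1) * 1.5708 := by
          gcongr
          · linarith
          · linarith
        _ = _ := by ring
    have h5 := hstep 5 (by norm_num) _ (by positivity) h6
    have h4' := hstep 4 (by norm_num) _ (by interval_cases k <;> norm_num) h5
    have h3 := hstep 3 (by norm_num) _ (by interval_cases k <;> norm_num) h4'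
    have h2 := hstep 2 (by norm_num) _ (by interval_cases k <;> norm_num) h3
    have h1 := hstep 1 (by norm_num) _ (by interval_cases k <;> norm_num) h2
    refine hfin _ (by interval_cases k <;> norm_num) h1 ?_
    interval_cases k <;> norm_num
  · have hk3 : k = 1 ∨ k = 2 ∨ k = 3 := by omega
    rcases hk3 with rfl | rfl | rfl
    -- the crude bounds are `5 · 3π/16`, `11 · 63π/512` and `13 · 231π/2048`
    · have h2 : e 2 ≤ 2.9453 := by
        have h := hcrude 2
        norm_num [halfLineConst] at h
        linarith
      have h1 := hstep 1 (by norm_num) _ (by norm_num) h2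
      exact hfin _ (by norm_num) h1 (by norm_num)
    · have h4 : e 4 ≤ 11 * 0.3866 := by
        have h := hcrude 4
        norm_num [halfLineConst] at h
        linarith
      have h3 := hstep 3 (by norm_num) _ (by norm_num) h4
      have h2 := hstep 2 (by norm_num) _ (by norm_num) h3
      have h1 := hstep 1 (by norm_num) _ (by norm_num) h2
      exact hfin _ (by norm_num) h1 (by norm_num)
    · have h4 : e 4 ≤ 13 * 0.3544 := by
        have h := hcrude 4
        norm_num [halfLineConst] at h
        linarith
      have h3 := hstep 3 (by norm_num) _ (by norm_num) h4
      have h2 := hstep 2 (by norm_num) _ (by norm_num) h3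
      have h1 := hstep 1 (by norm_num) _ (by norm_num) h2
      exact hfin _ (by norm_num) h1 (by norm_num)

theorem sq_le_five_pow {N : ℕ} (hN : 7 ≤ N) : 25 * (3 * (N : ℝ) + 2) ^ 2 ≤ 0.2 * 5 ^ N := by
  induction N, hN using Nat.le_induction with
  | base => norm_num
  | succ n hn ih =>
    have : (7 : ℝ) ≤ n := by exact_mod_cast hn
    have h2 : 25 * (3 * ((n + 1 : ℕ) : ℝ) + 2) ^ 2 ≤ 5 * (25 * (3 * (n : ℝ) + 2) ^ 2) := by
      push_cast
      nlinarith
    rw [pow_succ (5 : ℝ) n]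
    linarith

/-- For `k ≥ 21`, the recursion is started at `r = k / 3` and compared with
`q² / (1 - q²) + 5 k 5^{-(k/3 - r)}`, where `q = (k + r) / (π k)`. -/
theorem backward_bound_large {k : ℕ} (hk : 21 ≤ k) {e : ℕ → ℝ}
    (hrec : ∀ r, 1 ≤ r → e r ≤
      (2 * k + 2 * r) * (2 * k + 2 * r - 1) / (2 * π * k) ^ 2 * (1 + e (r + 1)))
    (hcrude : ∀ r, e r ≤ (2 * (k + r) - 1) * halfLineConst (k + r - 1)) :
    2 * k * (2 * k - 1) / (2 * π * k) ^ 2 * (1 + e 1) < 1 / (π ^ 2 - 1) := by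
  have hk1 : (21 : ℝ) ≤ k := by exact_mod_cast hk
  obtain ⟨N, hN⟩ : ∃ N, N = k / 3 := ⟨_, rfl⟩
  have hN7 : 7 ≤ N := by omega
  have hN3 : 3 * (N : ℝ) ≤ k := by exact_mod_cast (by omega : 3 * N ≤ k)
  have hkN : (k : ℝ) ≤ 3 * N + 2 := by exact_mod_cast (by omega : k ≤ 3 * N + 2)
  obtain ⟨hp1, hp2⟩ := pi_sq_bounds
  have hpi := pi_lt_d6
  have hk0 : (0 : ℝ) < (k : ℝ) ^ 2 := by positivity
  -- `π² k² - (k + r)²`, the denominator of the geometric majorant `q² / (1 - q²)`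
  have hden : ∀ r : ℕ, r ≤ N → 0 < π ^ 2 * k ^ 2 - ((k : ℝ) + r) ^ 2 := by
    intro r hr
    have hr' : (r : ℝ) ≤ N := by exact_mod_cast hr
    have hr0 : (0 : ℝ) ≤ r := by positivity
    have : ((k : ℝ) + r) ^ 2 ≤ 16 / 9 * k ^ 2 := by nlinarith
    nlinarith
  -- the induction runs downwards from `r = N`, with `i = N - r`
  have main : ∀ i : ℕ, i + 1 ≤ N →
      e (N - i) ≤ ((k : ℝ) + (N - i : ℕ)) ^ 2 / (π ^ 2 * k ^ 2 - ((k : ℝ) + (N - i : ℕ)) ^ 2)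
        + 5 * k * (1 / 5) ^ i := by
    intro i
    induction i with
    | zero =>
      intro _
      -- `2 (k + k / 3) · π / 2 < 5 k`
      have h : e N ≤ 5 * k :=
        calc e N ≤ (2 * (k + N) - 1) * halfLineConst (k + N - 1) := hcrude N
          _ ≤ (2 * (k + N) - 1) * (π / 2) := by
            gcongr
            · linarith
            · exact halfLineConst_le _
          _ ≤ (2 * (k + k / 3)) * 1.6 := by
            gcongr
            · linarith
            · linarith
          _ ≤ _ := by linarith
      have h1 := (hden N le_rfl)
      have : (0 : ℝ) ≤ ((k : ℝ) + (N : ℕ)) ^ 2 / (π ^ 2 * k ^ 2 - ((k : ℝ) + (N : ℕ)) ^ 2) := by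
        positivity
      simp only [Nat.sub_zero, pow_zero, mul_one]
      linarith
    | succ i ih =>
      intro hi
      have ih' := ih (by omega)
      obtain ⟨r, hr⟩ : ∃ r, r = N - (i + 1) := ⟨_, rfl⟩
      have hr1 : 1 ≤ r := by omega
      have hrN : r + 1 ≤ N := by omega
      have hri : N - i = r + 1 := by omega
      rw [hri] at ih'
      rw [← hr]
      have hd := hden r (by omega)
      have hd1 := hden (r + 1) hrN
      have hr1' : (1 : ℝ) ≤ r := by exact_mod_cast hr1
      have hrN' : (r : ℝ) + 1 ≤ N := by exact_mod_cast hrN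
      push_cast at ih' hd1
      obtain ⟨s, hs⟩ : ∃ s : ℝ, s = k + r := ⟨_, rfl⟩
      have hs1 : (k : ℝ) + (r + 1) = s + 1 := by rw [hs]; ring
      rw [hs1] at ih' hd1
      rw [← hs] at hd ⊢
      have hs0 : 0 < s := by linarith
      have hsk : 3 * s + 3 ≤ 4 * k := by linarith
      have hspos : 0 ≤ 2 * s * (2 * s - 1) / (2 * π * k) ^ 2 :=
        div_nonneg (mul_nonneg (by linarith) (by linarith)) (by positivity)
      -- this is `s (π² k² - 5 s² - 2 s) ≥ 0`, the condition that keeps the majorant stable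
      have hnum : s * (2 * s - 1) * (π ^ 2 * k ^ 2 - s ^ 2)
          ≤ 2 * s ^ 2 * (π ^ 2 * k ^ 2 - (s + 1) ^ 2) := by
        have h1 : 5 * s ^ 2 + 2 * s ≤ π ^ 2 * k ^ 2 := by
          have h2 : s ^ 2 ≤ ((4 * k - 3) / 3) ^ 2 := by gcongr; linarith
          have h3 : 9.8696 * (k : ℝ) ^ 2 ≤ π ^ 2 * k ^ 2 := by gcongr
          nlinarith only [h2, h3, hsk, hk1]
        linear_combination s * h1
      have hgeo : 2 * s * (2 * s - 1) / (2 * π * k) ^ 2 *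
          (1 + (s + 1) ^ 2 / (π ^ 2 * k ^ 2 - (s + 1) ^ 2)) ≤
            s ^ 2 / (π ^ 2 * k ^ 2 - s ^ 2) := by
        have : 2 * s * (2 * s - 1) / (2 * π * k) ^ 2 *
            (1 + (s + 1) ^ 2 / (π ^ 2 * k ^ 2 - (s + 1) ^ 2)) =
            s * (2 * s - 1) / (2 * (π ^ 2 * k ^ 2 - (s + 1) ^ 2)) := by
          have := hd1.ne'
          have := pi_pos.ne'
          field_simp
          ring
        rw [this, div_le_div_iff₀ (by linarith) hd]
        linarith
      have hfac : 2 * s * (2 * s - 1) / (2 * π * k) ^ 2 ≤ 1 / 5 := by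
        rw [div_le_iff₀ (by positivity)]
        have h2 : s ^ 2 ≤ ((4 * k - 3) / 3) ^ 2 := by gcongr; linarith
        have h3 : 9.8696 * (k : ℝ) ^ 2 ≤ π ^ 2 * k ^ 2 := by gcongr
        nlinarith only [h2, h3, hsk, hk1, hs0]
      have hE : (0 : ℝ) ≤ 5 * k * (1 / 5) ^ i := by positivity
      have hrec' := hrec r hr1
      have hc : (2 * (k : ℝ) + 2 * r) * (2 * k + 2 * r - 1) = 2 * s * (2 * s - 1) := by
        rw [hs]; ring
      rw [hc] at hrec'
      calc e r ≤ 2 * s * (2 * s - 1) / (2 * π * k) ^ 2 * (1 + e (r + 1)) := hrec'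
        _ ≤ 2 * s * (2 * s - 1) / (2 * π * k) ^ 2 *
            (1 + ((s + 1) ^ 2 / (π ^ 2 * k ^ 2 - (s + 1) ^ 2) + 5 * k * (1 / 5) ^ i)) := by
            gcongr
        _ = 2 * s * (2 * s - 1) / (2 * π * k) ^ 2 *
            (1 + (s + 1) ^ 2 / (π ^ 2 * k ^ 2 - (s + 1) ^ 2)) +
            2 * s * (2 * s - 1) / (2 * π * k) ^ 2 * (5 * k * (1 / 5) ^ i) := by ring
        _ ≤ s ^ 2 / (π ^ 2 * k ^ 2 - s ^ 2) + 1 / 5 * (5 * k * (1 / 5) ^ i) := by gcongr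
        _ = _ := by ring
  have h1 := main (N - 1) (by omega)
  have hd1 := hden 1 (by omega)
  rw [show N - (N - 1) = 1 by omega] at h1
  push_cast at h1 hd1
  obtain ⟨E, hE⟩ : ∃ E : ℝ, E = 5 * k * (1 / 5) ^ (N - 1) := ⟨_, rfl⟩
  have hEk : k * E ≤ 0.2 := by
    have h5 := sq_le_five_pow hN7
    have : k * E * 5 ^ N = 25 * (k : ℝ) ^ 2 := by
      rw [hE, show (5 : ℝ) ^ N = 5 ^ (N - 1) * 5 by rw [← pow_succ]; congr 1; omega]
      have : ((1 : ℝ) / 5) ^ (N - 1) * 5 ^ (N - 1) = 1 := by rw [← mul_pow]; norm_num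
      linear_combination 25 * (k : ℝ) ^ 2 * this
    have h6 : k * E * 5 ^ N ≤ 0.2 * 5 ^ N := by rw [this]; nlinarith
    exact le_of_mul_le_mul_right h6 (by positivity)
  have hE0 : 0 ≤ E := by rw [hE]; positivity
  rw [← hE] at h1
  have hpk : (0 : ℝ) ≤ 2 * k * (2 * k - 1) / (2 * π * k) ^ 2 :=
    div_nonneg (mul_nonneg (by linarith) (by linarith)) (by positivity)
  have hpi1 : 0 < π ^ 2 - 1 := by linarith
  calc 2 * k * (2 * k - 1) / (2 * π * k) ^ 2 * (1 + e 1)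
      ≤ 2 * k * (2 * k - 1) / (2 * π * k) ^ 2 *
        (1 + (((k : ℝ) + 1) ^ 2 / (π ^ 2 * k ^ 2 - ((k : ℝ) + 1) ^ 2) + E)) := by gcongr
    _ = k * (2 * k - 1) / (2 * (π ^ 2 * k ^ 2 - (k + 1) ^ 2)) +
        (2 * k - 1) / (2 * k) * E / π ^ 2 := by
        obtain ⟨D, hD⟩ : ∃ D, D = π ^ 2 * (k : ℝ) ^ 2 - (k + 1) ^ 2 := ⟨_, rfl⟩
        have hsq : ((k : ℝ) + 1) ^ 2 = π ^ 2 * k ^ 2 - D := by rw [hD]; ring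
        rw [← hD] at hd1 ⊢
        rw [hsq]
        have := hd1.ne'
        have := pi_pos.ne'
        field_simp
        ring
    _ ≤ k * (2 * k - 1) / (2 * (π ^ 2 * k ^ 2 - (k + 1) ^ 2)) + E / π ^ 2 := by
        gcongr
        refine mul_le_of_le_one_left hE0 ?_
        rw [div_le_one (by positivity)]
        linarith
    _ < 1 / (π ^ 2 - 1) := by
        rw [← lt_sub_iff_add_lt', div_lt_iff₀ (by positivity)]
        -- the gain from `2 k - 1 < 2 k` outweighs the growth of `q`, because `5 < π²`
        have hdiff : 1 / (π ^ 2 - 1) - k * (2 * k - 1) / (2 * (π ^ 2 * k ^ 2 - (k + 1) ^ 2)) =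
            (k * (π ^ 2 - 5) - 2) / (2 * (π ^ 2 - 1) * (π ^ 2 * k ^ 2 - (k + 1) ^ 2)) := by
          have := hd1.ne'
          field_simp
          ring
        rw [hdiff, div_mul_eq_mul_div, lt_div_iff₀ (by positivity)]
        have hup : π ^ 2 * k ^ 2 - (k + 1) ^ 2 ≤ (π ^ 2 - 1) * k ^ 2 := by nlinarith
        have h2 : E * (2 * (π ^ 2 - 1) * (π ^ 2 * k ^ 2 - (k + 1) ^ 2)) ≤
            0.4 * (π ^ 2 - 1) ^ 2 * k := by
          calc E * (2 * (π ^ 2 - 1) * (π ^ 2 * k ^ 2 - (k + 1) ^ 2))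
              ≤ E * (2 * (π ^ 2 - 1) * ((π ^ 2 - 1) * k ^ 2)) := by gcongr
            _ = (k * E) * (2 * (π ^ 2 - 1) ^ 2 * k) := by ring
            _ ≤ 0.2 * (2 * (π ^ 2 - 1) ^ 2 * k) := by gcongr
            _ = _ := by ring
        have h3 : 0.4 * (π ^ 2 - 1) ^ 2 ≤ 32 := by nlinarith
        have h4 : 4.7 ≤ π ^ 2 - 5 - 2 / k := by
          have : (2 : ℝ) / k ≤ 2 / 21 := by gcongr
          norm_num at this ⊢
          linarith
        have h5 : k * (π ^ 2 - 5) - 2 = k * (π ^ 2 - 5 - 2 / k) := by field_simp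
        rw [h5]
        nlinarith [mul_le_mul_of_nonneg_left h4 (by linarith : (0 : ℝ) ≤ k)]

/-- A sequence which satisfies the recursive inequality and the crude bound is small enough at
`r = 1` for one more step to give a value below `1 / (π² - 1)`. -/
theorem backward_bound {k : ℕ} (hk : 1 ≤ k) {e : ℕ → ℝ}
    (hrec : ∀ r, 1 ≤ r → e r ≤
      (2 * k + 2 * r) * (2 * k + 2 * r - 1) / (2 * π * k) ^ 2 * (1 + e (r + 1)))
    (hcrude : ∀ r, e r ≤ (2 * (k + r) - 1) * halfLineConst (k + r - 1)) :
    2 * k * (2 * k - 1) / (2 * π * k) ^ 2 * (1 + e 1) < 1 / (π ^ 2 - 1) := by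
  rcases le_or_gt k 20 with h | h
  · exact backward_bound_small hk h hrec hcrude
  · exact backward_bound_large h hrec hcrude

/-! ### Cosine integrals in the right half-plane -/

/-- The geometric fact about the closed right half-plane on which all estimates rest. -/
theorem sq_add_sq_norm_le {z : ℂ} (hre : 0 ≤ z.re) {u : ℝ} (hu : 0 ≤ u) :
    u ^ 2 + ‖z‖ ^ 2 ≤ ‖(u : ℂ) + z‖ ^ 2 := by
  rw [Complex.sq_norm, Complex.sq_norm, Complex.normSq_apply, Complex.normSq_apply]
  simp only [Complex.add_re, Complex.add_im, Complex.ofReal_re, Complex.ofReal_im]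
  nlinarith [mul_nonneg hre hu]

theorem ofReal_add_ne_zero {z : ℂ} (hz : z ≠ 0) (hre : 0 ≤ z.re) {u : ℝ} (hu : 0 ≤ u) :
    (u : ℂ) + z ≠ 0 := by
  intro h
  have h1 := sq_add_sq_norm_le hre hu
  have h2 := norm_pos_iff.mpr hz
  rw [h, norm_zero] at h1
  nlinarith [sq_nonneg u]

/-- Only even exponents occur, so that the bound is rational in `u² + |z|²`. -/
theorem norm_div_ofReal_add_pow_le {z : ℂ} (hz : z ≠ 0) (hre : 0 ≤ z.re) (m : ℕ) {u : ℝ}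
    (hu : 0 ≤ u) {a : ℂ} (ha : ‖a‖ ≤ 1) :
    ‖a / ((u : ℂ) + z) ^ (2 * m + 2)‖ ≤ ((u ^ 2 + ‖z‖ ^ 2) ^ (m + 1))⁻¹ := by
  have hz' := norm_pos_iff.mpr hz
  rw [norm_div, norm_pow, ← one_div, show 2 * m + 2 = 2 * (m + 1) by ring, pow_mul]
  gcongr
  exact sq_add_sq_norm_le hre hu

theorem integrableOn_inv_sq_add_sq_pow {W : ℝ} (hW : 0 < W) (m : ℕ) :
    IntegrableOn (fun u : ℝ => ((u ^ 2 + W ^ 2) ^ (m + 1))⁻¹) (Ioi 0) := by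
  have hbase : Integrable fun u : ℝ => ((W ^ 2) ^ (m + 1))⁻¹ * (1 + (u / W) ^ 2)⁻¹ :=
    (integrable_inv_one_add_sq.comp_div hW.ne').const_mul _
  refine (hbase.mono' ?_ (Eventually.of_forall fun u => ?_)).integrableOn
  · refine Continuous.aestronglyMeasurable (Continuous.inv₀ (by fun_prop) fun u => ?_)
    positivity
  · rw [norm_of_nonneg (by positivity), ← mul_inv]
    gcongr
    calc (W ^ 2) ^ (m + 1) * (1 + (u / W) ^ 2)
        ≤ (W ^ 2) ^ (m + 1) * (1 + (u / W) ^ 2) ^ (m + 1) := by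
          gcongr
          exact le_self_pow₀ (by nlinarith [sq_nonneg (u / W)]) (by omega)
      _ = (u ^ 2 + W ^ 2) ^ (m + 1) := by
          rw [← mul_pow]
          congr 1
          field_simp
          ring

theorem integral_inv_sq_add_sq_pow {W : ℝ} (hW : 0 < W) (m : ℕ) :
    ∫ u in Ioi (0 : ℝ), ((u ^ 2 + W ^ 2) ^ (m + 1))⁻¹ =
      halfLineConst m / W ^ (2 * m + 1) := by
  induction m with
  | zero =>
    have hderiv : ∀ u : ℝ, HasDerivAt (fun u : ℝ => arctan (u / W) / W)
        (((u ^ 2 + W ^ 2) ^ (0 + 1))⁻¹) u := by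
      intro u
      have h := (((hasDerivAt_id u).div_const W).arctan).div_const W
      refine h.congr_deriv ?_
      have h1 : u ^ 2 + W ^ 2 ≠ 0 := by positivity
      simp only [id]
      field_simp
      ring
    have hlim : Tendsto (fun u : ℝ => arctan (u / W) / W) atTop (𝓝 (π / 2 / W)) :=
      ((tendsto_nhds_of_tendsto_nhdsWithin tendsto_arctan_atTop).comp
        (tendsto_id.atTop_div_const hW)).div_const W
    rw [integral_Ioi_of_hasDerivAt_of_tendsto (hderiv 0).continuousAt.continuousWithinAt
      (fun u _ => hderiv u) (integrableOn_inv_sq_add_sq_pow hW 0) hlim]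
    simp [halfLineConst]
  | succ m ih =>
    have hderiv : ∀ u : ℝ, HasDerivAt (fun u : ℝ => u / (u ^ 2 + W ^ 2) ^ (m + 1))
        ((2 * m + 2) * W ^ 2 * ((u ^ 2 + W ^ 2) ^ (m + 1 + 1))⁻¹
          - (2 * m + 1) * ((u ^ 2 + W ^ 2) ^ (m + 1))⁻¹) u := by
      intro u
      have h1 : u ^ 2 + W ^ 2 ≠ 0 := by positivity
      have h := (hasDerivAt_id u).fun_div
        ((((hasDerivAt_id u).fun_pow 2).add_const (W ^ 2)).fun_pow (m + 1)) (pow_ne_zero _ h1)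
      refine h.congr_deriv ?_
      simp only [id, Nat.add_sub_cancel]
      push_cast
      field_simp
      ring
    have hint1 := (integrableOn_inv_sq_add_sq_pow hW (m + 1)).const_mul ((2 * m + 2) * W ^ 2)
    have hint0 := (integrableOn_inv_sq_add_sq_pow hW m).const_mul (2 * (m : ℝ) + 1)
    have hlim : Tendsto (fun u : ℝ => u / (u ^ 2 + W ^ 2) ^ (m + 1)) atTop (𝓝 0) := by
      have hupper : Tendsto (fun u : ℝ => ((W ^ 2) ^ m)⁻¹ * u⁻¹) atTop (𝓝 0) := by
        simpa using tendsto_inv_atTop_zero.const_mul (((W ^ 2) ^ m)⁻¹)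
      refine squeeze_zero' ?_ ?_ hupper
      · filter_upwards [eventually_ge_atTop 0] with u hu
        positivity
      · filter_upwards [eventually_gt_atTop 0] with u hu
        rw [← mul_inv, ← one_div, div_le_div_iff₀ (by positivity) (by positivity), pow_succ]
        have h2 : (W ^ 2) ^ m ≤ (u ^ 2 + W ^ 2) ^ m := by
          gcongr
          nlinarith
        calc u * ((W ^ 2) ^ m * u) = (W ^ 2) ^ m * u ^ 2 := by ring
          _ ≤ (u ^ 2 + W ^ 2) ^ m * (u ^ 2 + W ^ 2) := by
            gcongr
            nlinarith
          _ = _ := by ring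
    have hFTC := integral_Ioi_of_hasDerivAt_of_tendsto (a := 0)
      (hderiv 0).continuousAt.continuousWithinAt (fun u _ => hderiv u) (hint1.sub hint0) hlim
    rw [integral_sub hint1 hint0, integral_const_mul, integral_const_mul, ih] at hFTC
    simp only [zero_div, sub_zero, halfLineConst] at hFTC ⊢
    have hpos : (2 * (m : ℝ) + 2) * W ^ 2 ≠ 0 := by positivity
    apply mul_left_cancel₀ hpos
    rw [sub_eq_zero.mp hFTC]
    field_simp
    ring

/-- The integral `∫_0^∞ cos (ω u) / (u + z)^{2m+2} du`; it converges absolutely for `z ≠ 0` in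
the closed right half-plane. -/
noncomputable def cosIntegral (ω : ℝ) (m : ℕ) (z : ℂ) : ℂ :=
  ∫ u in Ioi (0 : ℝ), (Real.cos (ω * u) : ℂ) / ((u : ℂ) + z) ^ (2 * m + 2)

theorem integrableOn_div_ofReal_add_pow {z : ℂ} (hz : z ≠ 0) (hre : 0 ≤ z.re) (m : ℕ)
    {f : ℝ → ℂ} (hf : Continuous f) (hf1 : ∀ u, ‖f u‖ ≤ 1) :
    IntegrableOn (fun u : ℝ => f u / ((u : ℂ) + z) ^ (2 * m + 2)) (Ioi 0) := by
  refine Integrable.mono' (integrableOn_inv_sq_add_sq_pow (norm_pos_iff.mpr hz) m) ?_ ?_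
  · refine ContinuousOn.aestronglyMeasurable (ContinuousOn.div hf.continuousOn (by fun_prop) ?_)
      measurableSet_Ioi
    intro u hu
    exact pow_ne_zero _ (ofReal_add_ne_zero hz hre (le_of_lt hu))
  · filter_upwards [ae_restrict_mem measurableSet_Ioi] with u hu
    exact norm_div_ofReal_add_pow_le hz hre m (le_of_lt hu) (hf1 u)

theorem norm_ofReal_cos_le_one (x : ℝ) : ‖(Real.cos x : ℂ)‖ ≤ 1 := by
  rw [Complex.norm_real]
  exact abs_cos_le_one x

theorem integrableOn_cos_div {z : ℂ} (hz : z ≠ 0) (hre : 0 ≤ z.re) (ω : ℝ) (m : ℕ) :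
    IntegrableOn (fun u : ℝ => (Real.cos (ω * u) : ℂ) / ((u : ℂ) + z) ^ (2 * m + 2)) (Ioi 0) :=
  integrableOn_div_ofReal_add_pow hz hre m (by fun_prop) fun _ => norm_ofReal_cos_le_one _

theorem norm_cosIntegral_le {z : ℂ} (hz : z ≠ 0) (hre : 0 ≤ z.re) (ω : ℝ) (m : ℕ) :
    ‖cosIntegral ω m z‖ ≤ halfLineConst m / ‖z‖ ^ (2 * m + 1) := by
  have hz' := norm_pos_iff.mpr hz
  rw [← integral_inv_sq_add_sq_pow hz' m]
  refine norm_integral_le_of_norm_le (integrableOn_inv_sq_add_sq_pow hz' m) ?_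
  filter_upwards [ae_restrict_mem measurableSet_Ioi] with u hu
  exact norm_div_ofReal_add_pow_le hz hre m (le_of_lt hu) (norm_ofReal_cos_le_one _)

theorem tendsto_bounded_div_ofReal_add_pow {z : ℂ} {f : ℝ → ℂ} (hre : 0 ≤ z.re)
    (hf : ∀ u, ‖f u‖ ≤ 1) (n : ℕ) :
    Tendsto (fun u : ℝ => f u / ((u : ℂ) + z) ^ (n + 1)) atTop (𝓝 0) := by
  refine squeeze_zero_norm' ?_ tendsto_inv_atTop_zero
  filter_upwards [eventually_ge_atTop 1] with u hu
  have h1 : u ≤ ‖(u : ℂ) + z‖ := by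
    have := sq_add_sq_norm_le hre (by linarith : (0 : ℝ) ≤ u)
    exact le_of_sq_le_sq (by nlinarith [sq_nonneg ‖z‖]) (norm_nonneg _)
  rw [norm_div, norm_pow, ← one_div]
  gcongr
  · exact hf u
  · exact h1.trans (le_self_pow₀ (hu.trans h1) (by omega))

/-- Two integrations by parts. -/
theorem cosIntegral_eq {z : ℂ} (hz : z ≠ 0) (hre : 0 ≤ z.re) {ω : ℝ} (hω : ω ≠ 0) (m : ℕ) :
    cosIntegral ω m z = (2 * m + 2) / (ω ^ 2 * z ^ (2 * m + 3)) -
      (2 * m + 2) * (2 * m + 3) / ω ^ 2 * cosIntegral ω (m + 1) z := by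
  have hω' : (ω : ℂ) ≠ 0 := by exact_mod_cast hω
  have hderiv : ∀ u : ℝ, 0 ≤ u → HasDerivAt
      (fun u : ℝ => (1 / ω : ℂ) * ((Real.sin (ω * u) : ℂ) / ((u : ℂ) + z) ^ (2 * m + 1 + 1)) -
        (2 * m + 2) / (ω : ℂ) ^ 2 * ((Real.cos (ω * u) : ℂ) / ((u : ℂ) + z) ^ (2 * m + 2 + 1)))
      ((Real.cos (ω * u) : ℂ) / ((u : ℂ) + z) ^ (2 * m + 2) +
        (2 * m + 2) * (2 * m + 3) / (ω : ℂ) ^ 2 *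
          ((Real.cos (ω * u) : ℂ) / ((u : ℂ) + z) ^ (2 * (m + 1) + 2))) u := by
    intro u hu
    have hne := ofReal_add_ne_zero hz hre hu
    have hlin : HasDerivAt (fun u : ℝ => (u : ℂ) + z) 1 u :=
      ((hasDerivAt_id u).ofReal_comp).add_const z
    have hmul : HasDerivAt (fun u : ℝ => ω * u) ω u := by
      simpa using (hasDerivAt_id u).const_mul ω
    have hsin : HasDerivAt (fun u : ℝ => (Real.sin (ω * u) : ℂ))
        ((Real.cos (ω * u) * ω : ℝ) : ℂ) u := (hmul.sin).ofReal_comp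
    have hcos : HasDerivAt (fun u : ℝ => (Real.cos (ω * u) : ℂ))
        ((-Real.sin (ω * u) * ω : ℝ) : ℂ) u := (hmul.cos).ofReal_comp
    have h := ((hsin.fun_div (hlin.fun_pow (2 * m + 1 + 1)) (pow_ne_zero _ hne)).const_mul
      (1 / ω : ℂ)).fun_sub ((hcos.fun_div (hlin.fun_pow (2 * m + 2 + 1))
        (pow_ne_zero _ hne)).const_mul
        ((2 * m + 2) / (ω : ℂ) ^ 2))
    refine h.congr_deriv ?_
    simp only [Nat.add_sub_cancel]
    push_cast
    generalize Complex.cos (ω * u) = C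
    generalize Complex.sin (ω * u) = S
    rw [show 2 * (m + 1) + 2 = 2 * m + 4 by ring, show 2 * m + 1 + 1 = 2 * m + 2 by ring,
      show 2 * m + 2 + 1 = 2 * m + 3 by ring]
    generalize (u : ℂ) + z = y at hne
    field_simp
    ring
  have hint0 := integrableOn_cos_div hz hre ω m
  have hint1 := (integrableOn_cos_div hz hre ω (m + 1)).const_mul
    ((2 * m + 2) * (2 * m + 3) / (ω : ℂ) ^ 2)
  have hlim : Tendsto
      (fun u : ℝ => (1 / ω : ℂ) * ((Real.sin (ω * u) : ℂ) / ((u : ℂ) + z) ^ (2 * m + 1 + 1)) -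
        (2 * m + 2) / (ω : ℂ) ^ 2 * ((Real.cos (ω * u) : ℂ) / ((u : ℂ) + z) ^ (2 * m + 2 + 1)))
      atTop (𝓝 0) := by
    have hs : ∀ u : ℝ, ‖(Real.sin (ω * u) : ℂ)‖ ≤ 1 := fun u => by
      rw [Complex.norm_real]
      exact abs_sin_le_one _
    have h1 := (tendsto_bounded_div_ofReal_add_pow hre hs (2 * m + 1)).const_mul (1 / ω : ℂ)
    have h2 := (tendsto_bounded_div_ofReal_add_pow hre
      (fun u => norm_ofReal_cos_le_one (ω * u)) (2 * m + 2)).const_mul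
        ((2 * m + 2) / (ω : ℂ) ^ 2)
    simpa using h1.sub h2
  have hFTC := integral_Ioi_of_hasDerivAt_of_tendsto (a := 0)
    (hderiv 0 le_rfl).continuousAt.continuousWithinAt (fun u hu => hderiv u (le_of_lt hu))
    (hint0.add hint1) hlim
  rw [integral_add hint0 hint1, integral_const_mul] at hFTC
  simp only [mul_zero, Real.sin_zero, Real.cos_zero, Complex.ofReal_zero, zero_div, zero_add,
    Complex.ofReal_one, zero_sub, sub_neg_eq_add] at hFTC
  unfold cosIntegral
  rw [eq_sub_iff_add_eq, hFTC]
  field_simp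

/-- The estimate for one frequency; it yields the theorem by summation over `ω = 2 π n`. -/
theorem cosIntegral_lt {k : ℕ} (hk : 1 ≤ k) {z : ℂ} (hz : z ≠ 0) (hre : 0 ≤ z.re)
    (hkz : (k : ℝ) ≤ ‖z‖) {ω : ℝ} (hω : 2 * π ≤ ω) :
    (2 * k - 1) * ‖z‖ ^ (2 * k - 1) * ‖cosIntegral ω (k - 1) z‖ <
      (k / ‖z‖) ^ 2 / (π ^ 2 - 1) := by
  obtain ⟨j, rfl⟩ : ∃ j, k = j + 1 := ⟨k - 1, by omega⟩
  have hz' := norm_pos_iff.mpr hz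
  have hω0 : 0 < ω := by have := pi_pos; linarith
  set e : ℕ → ℝ := fun r =>
    (2 * (j + r : ℕ) + 1) * ‖z‖ ^ (2 * (j + r) + 1) * ‖cosIntegral ω (j + r) z‖ with he
  have hrec : ∀ r, e r ≤ (2 * (j + 1 : ℕ) + 2 * r) * (2 * (j + 1 : ℕ) + 2 * r - 1) /
      (2 * π * ‖z‖) ^ 2 * (1 + e (r + 1)) := by
    intro r
    have h1 : ‖cosIntegral ω (j + r) z‖ ≤
        (2 * (j + r : ℕ) + 2) / (ω ^ 2 * ‖z‖ ^ (2 * (j + r) + 3)) +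
        (2 * (j + r : ℕ) + 2) * (2 * (j + r : ℕ) + 3) / ω ^ 2 * ‖cosIntegral ω (j + r + 1) z‖ := by
      rw [cosIntegral_eq hz hre hω0.ne' (j + r)]
      refine (norm_sub_le _ _).trans (le_of_eq ?_)
      have e1 : ‖(2 * ((j + r : ℕ) : ℂ) + 2)‖ = 2 * ((j + r : ℕ) : ℝ) + 2 := by
        exact_mod_cast Complex.norm_natCast (2 * (j + r) + 2)
      have e2 : ‖(2 * ((j + r : ℕ) : ℂ) + 3)‖ = 2 * ((j + r : ℕ) : ℝ) + 3 := by
        exact_mod_cast Complex.norm_natCast (2 * (j + r) + 3)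
      simp only [norm_div, norm_mul, norm_pow, Complex.norm_real, norm_of_nonneg hω0.le, e1, e2]
    have h2 : 0 ≤ e (r + 1) := by simp only [he]; positivity
    calc e r ≤ (2 * (j + r : ℕ) + 1) * ‖z‖ ^ (2 * (j + r) + 1) *
          ((2 * (j + r : ℕ) + 2) / (ω ^ 2 * ‖z‖ ^ (2 * (j + r) + 3)) +
        (2 * (j + r : ℕ) + 2) * (2 * (j + r : ℕ) + 3) / ω ^ 2 *
          ‖cosIntegral ω (j + r + 1) z‖) := by
          simp only [he]
          gcongr
      _ = (2 * (j + 1 : ℕ) + 2 * r) * (2 * (j + 1 : ℕ) + 2 * r - 1) /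
            (ω * ‖z‖) ^ 2 * (1 + e (r + 1)) := by
          simp only [he, ← add_assoc]
          push_cast
          field_simp
          ring
      _ ≤ _ := by
          have : (0 : ℝ) ≤ 2 * (j + 1 : ℕ) + 2 * r - 1 := by
            push_cast
            linarith [(by positivity : (0 : ℝ) ≤ j), (by positivity : (0 : ℝ) ≤ r)]
          gcongr
  have hcrude : ∀ r, e r ≤ (2 * ((j + 1 : ℕ) + r) - 1) * halfLineConst (j + 1 + r - 1) := by
    intro r
    have h1 := norm_cosIntegral_le hz hre ω (j + r)
    rw [show j + 1 + r - 1 = j + r by omega]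
    calc e r ≤ (2 * (j + r : ℕ) + 1) * ‖z‖ ^ (2 * (j + r) + 1) *
          (halfLineConst (j + r) / ‖z‖ ^ (2 * (j + r) + 1)) := by
          simp only [he]
          gcongr
      _ = _ := by
          push_cast
          field_simp
          ring
  have hmain := backward_bound hk (e := e) ?_ hcrude
  · have h0 := hrec 0
    have he0 : e 0 = (2 * (j + 1 : ℕ) - 1) * ‖z‖ ^ (2 * (j + 1) - 1) *
        ‖cosIntegral ω (j + 1 - 1) z‖ := by
      simp only [he, add_zero, Nat.add_sub_cancel]
      rw [show 2 * (j + 1) - 1 = 2 * j + 1 by omega]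
      push_cast
      ring
    rw [← he0]
    refine h0.trans_lt ?_
    have hk0 : (0 : ℝ) < (j + 1 : ℕ) := by positivity
    have := mul_lt_mul_of_pos_left hmain
      (by positivity : 0 < (((j + 1 : ℕ) : ℝ) / ‖z‖) ^ 2)
    refine (le_of_eq ?_).trans_lt (this.trans_le (le_of_eq (by ring)))
    have := pi_pos
    simp only [zero_add, Nat.cast_zero, mul_zero, add_zero]
    field_simp
  · intro r hr
    have h2 : 0 ≤ e (r + 1) := by simp only [he]; positivity
    have : (0 : ℝ) ≤ 2 * (j + 1 : ℕ) + 2 * r - 1 := by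
      push_cast
      linarith [(by positivity : (0 : ℝ) ≤ j), (by positivity : (0 : ℝ) ≤ r)]
    refine (hrec r).trans ?_
    gcongr

/-! ### The remainder as a sum of midpoint-rule errors, and as an integral -/

theorem add_ofReal_mem_slitPlane {z : ℂ} (hz : z ≠ 0) (hre : 0 ≤ z.re) {u : ℝ} (hu : 0 ≤ u) :
    z + u ∈ Complex.slitPlane := by
  rw [Complex.mem_slitPlane_iff]
  simp only [Complex.add_re, Complex.add_im, Complex.ofReal_re, Complex.ofReal_im, add_zero]
  rcases hre.lt_or_eq with h | h
  · left; linarith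
  · right
    intro him
    exact hz (Complex.ext h.symm him)

/-- The antiderivative `z log z - z` of the principal logarithm. -/
noncomputable def logPrimitive (z : ℂ) : ℂ := z * Complex.log z - z

/-- The error `∫_w^{w+1} log - log (w + 1/2)` of the midpoint rule for the logarithm, with the
integral evaluated. -/
noncomputable def midpointError (w : ℂ) : ℂ :=
  logPrimitive (w + 1) - logPrimitive w - Complex.log (w + 1 / 2)

/-- Partial sums of the Weierstrass series in the form of Gauss's limit for `Γ`. -/
theorem sum_logGammaTerm_eq {w : ℂ} (hwn : ∀ m : ℕ, w + m ≠ 0)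
    (n : ℕ) :
    -(Real.eulerMascheroniConstant : ℂ) * w - Complex.log w +
      ∑ m ∈ Finset.range n, logGammaTerm m w =
    w * ((((harmonic n : ℚ) : ℝ) - Real.eulerMascheroniConstant : ℝ) : ℂ) +
      (Real.log (n.factorial : ℝ) : ℂ) - ∑ m ∈ Finset.range (n + 1), Complex.log (w + m) := by
  induction n with
  | zero => simp; ring
  | succ n ih =>
    have hpos : (0 : ℝ) < (n : ℝ) + 1 := by positivity
    have hsplit : Complex.log (1 + w / ((n : ℂ) + 1)) =
        Complex.log (w + ((n + 1 : ℕ) : ℂ)) - (Real.log ((n : ℝ) + 1) : ℂ) := by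
      have h1 : w + ((n + 1 : ℕ) : ℂ) = (((n : ℝ) + 1 : ℝ) : ℂ) * (1 + w / ((n : ℂ) + 1)) := by
        have : (n : ℂ) + 1 ≠ 0 := by exact_mod_cast hpos.ne'
        push_cast
        field_simp
        ring
      have h2 := hwn (n + 1)
      rw [h1] at h2 ⊢
      rw [Complex.log_ofReal_mul hpos (right_ne_zero_of_mul h2)]
      ring
    rw [Finset.sum_range_succ, ← add_assoc, ih, Finset.sum_range_succ _ (n + 1), logGammaTerm,
      hsplit, Nat.factorial_succ, harmonic_succ, Nat.cast_mul,
      Real.log_mul (by positivity) (by positivity)]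
    push_cast
    have : (n : ℂ) + 1 ≠ 0 := by exact_mod_cast hpos.ne'
    field_simp
    ring

/-- The primitives telescope, and the logarithms are those of `Γ (z + 1/2)` in
`sum_logGammaTerm_eq`. -/
theorem sum_midpointError (z : ℂ) (n : ℕ) :
    ∑ m ∈ Finset.range n, midpointError (z + m) =
      logPrimitive (z + n) - logPrimitive z
        - ∑ m ∈ Finset.range n, Complex.log (z + 1 / 2 + m) := by
  induction n with
  | zero => simp
  | succ n ih =>
    rw [Finset.sum_range_succ, ih, Finset.sum_range_succ, midpointError]
    push_cast
    rw [show z + (n : ℂ) + 1 / 2 = z + 1 / 2 + n by ring, ← add_assoc]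
    ring

/-- Stirling's formula for `log n!`. -/
theorem tendsto_log_factorial_sub :
    Tendsto (fun n : ℕ => Real.log (n.factorial : ℝ) -
      (((n : ℝ) + 1 / 2) * Real.log n - n)) atTop (𝓝 (1 / 2 * Real.log (2 * π))) := by
  have h := (Real.continuousAt_log (by positivity : √π ≠ 0)).tendsto.comp
    Stirling.tendsto_stirlingSeq_sqrt_pi
  have h2 := h.add_const (1 / 2 * Real.log 2)
  have e : Real.log √π + 1 / 2 * Real.log 2 = 1 / 2 * Real.log (2 * π) := by
    rw [Real.log_sqrt pi_pos.le, Real.log_mul (by norm_num) pi_pos.ne']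
    ring
  rw [e] at h2
  refine h2.congr' ?_
  filter_upwards [eventually_gt_atTop 0] with n hn
  have hn' : (0 : ℝ) < n := by exact_mod_cast hn
  simp only [Function.comp_apply]
  rw [Stirling.log_stirlingSeq_formula, Real.log_mul (by norm_num) hn'.ne',
    Real.log_div hn'.ne' (Real.exp_pos 1).ne', Real.log_exp]
  ring

theorem tendsto_logPrimitive_sub (a : ℂ) :
    Tendsto (fun n : ℕ => logPrimitive (n + a) - (((n : ℂ) + a) * (Real.log n : ℂ) - n))
      atTop (𝓝 0) := by
  have hg : Tendsto (fun x : ℝ => (x : ℂ) * (a / x)) atTop (𝓝 a) := by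
    refine tendsto_const_nhds.congr' ?_
    filter_upwards [eventually_ne_atTop 0] with x hx
    have : (x : ℂ) ≠ 0 := by exact_mod_cast hx
    field_simp
  have h1 : Tendsto (fun n : ℕ => (n : ℂ) * Complex.log (1 + a / n)) atTop (𝓝 a) := by
    have := (Complex.tendsto_mul_log_one_add_of_tendsto hg).comp tendsto_natCast_atTop_atTop
    simpa [Function.comp_def] using this
  have hinv : Tendsto (fun n : ℕ => a / (n : ℂ)) atTop (𝓝 0) := by
    have := (tendsto_inv_atTop_nhds_zero_nat (𝕜 := ℂ)).const_mul a
    simpa [div_eq_mul_inv] using this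
  have hone : Tendsto (fun n : ℕ => 1 + a / (n : ℂ)) atTop (𝓝 1) := by
    simpa using hinv.const_add 1
  have h2 : Tendsto (fun n : ℕ => Complex.log (1 + a / n)) atTop (𝓝 0) := by
    have := (continuousAt_clog Complex.one_mem_slitPlane).tendsto.comp hone
    simpa [Function.comp_def] using this
  have h3 := (h1.add (h2.const_mul a)).sub_const a
  rw [mul_zero, add_zero, sub_self] at h3
  refine h3.congr' ?_
  filter_upwards [eventually_gt_atTop 0, hone.eventually_ne one_ne_zero] with n hn hne
  have hn' : (0 : ℝ) < n := by exact_mod_cast hn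
  have hnc : (n : ℂ) ≠ 0 := by exact_mod_cast hn'.ne'
  have hlog : Complex.log (n + a) = Real.log n + Complex.log (1 + a / n) := by
    rw [← Complex.log_ofReal_mul hn' hne]
    congr 1
    push_cast
    field_simp
  rw [logPrimitive, hlog]
  ring

/-- The remainder `R̂_1(z)` is the sum of all midpoint-rule errors along `z + m`. -/
theorem tendsto_sum_midpointError {z : ℂ} (hz : z ≠ 0) (hre : 0 ≤ z.re) :
    Tendsto (fun n : ℕ => ∑ m ∈ Finset.range n, midpointError (z + m)) atTop (𝓝 (Rhat 1 z)) := by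
  rw [← tendsto_add_atTop_iff_nat 1]
  have hw : z + 1 / 2 ∈ Complex.slitPlane := by
    have := add_ofReal_mem_slitPlane hz hre (u := 1 / 2) (by norm_num)
    push_cast at this
    exact this
  have hwn : ∀ m : ℕ, z + 1 / 2 + m ≠ 0 := by
    intro m h
    have := congrArg Complex.re h
    simp at this
    have hm : (0 : ℝ) ≤ m := by positivity
    linarith
  have hL := ((summable_logGammaTerm (z + 1 / 2)).hasSum.tendsto_sum_nat).const_add
    (-(Real.eulerMascheroniConstant : ℂ) * (z + 1 / 2) - Complex.log (z + 1 / 2))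
  simp only [sum_logGammaTerm_eq hwn] at hL
  have hH : Tendsto (fun n : ℕ => (z + 1 / 2) *
      ((((harmonic n : ℚ) : ℝ) - Real.log n - Real.eulerMascheroniConstant : ℝ) : ℂ))
      atTop (𝓝 0) := by
    have := ((Complex.continuous_ofReal.tendsto _).comp
      (Real.tendsto_harmonic_sub_log.sub_const Real.eulerMascheroniConstant)).const_mul (z + 1 / 2)
    simpa [Function.comp_def] using this
  have hS := (Complex.continuous_ofReal.tendsto _).comp tendsto_log_factorial_sub
  have hP := tendsto_logPrimitive_sub (z + 1)
  have hall := ((hL.sub hH).sub hS).add hP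
  have htarget : Rhat 1 z = (-(Real.eulerMascheroniConstant : ℂ) * (z + 1 / 2) -
      Complex.log (z + 1 / 2) + ∑' n : ℕ, logGammaTerm n (z + 1 / 2)) - 0 -
      ((1 / 2 * Real.log (2 * π) : ℝ) : ℂ) + 0 - logPrimitive z := by
    simp only [Rhat, logGamma, logPrimitive, Finset.Ico_self, Finset.sum_empty]
    push_cast
    ring
  rw [htarget]
  refine (hall.sub_const (logPrimitive z)).congr fun n => ?_
  rw [sum_midpointError]
  simp only [Function.comp_apply]
  push_cast
  rw [show (n : ℂ) + (z + 1) = z + (n + 1) by ring]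
  ring

/-- The `1`-periodic function `∑_{n ≥ 1} (-1)^n cos (2 π n u) / n²`, a multiple of the periodic
Bernoulli function `B_2({u + 1/2})`. The term at `n = 0` is zero, as a division by zero. -/
noncomputable def alternatingCosSeries (u : ℝ) : ℝ :=
  ∑' n : ℕ, (-1) ^ n / (n : ℝ) ^ 2 * Real.cos (2 * π * n * u)

theorem summable_inv_sq : Summable fun n : ℕ => 1 / (n : ℝ) ^ 2 :=
  Real.summable_one_div_nat_pow.mpr one_lt_two

theorem norm_alternatingCosSeries_term_le (n : ℕ) (u : ℝ) :
    ‖(-1) ^ n / (n : ℝ) ^ 2 * Real.cos (2 * π * n * u)‖ ≤ 1 / (n : ℝ) ^ 2 := by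
  rw [norm_mul, norm_div, norm_pow, norm_neg, norm_one, one_pow, norm_pow, Real.norm_natCast]
  exact mul_le_of_le_one_right (by positivity) (abs_cos_le_one _)

theorem continuous_alternatingCosSeries : Continuous alternatingCosSeries :=
  continuous_tsum (fun n => by fun_prop) summable_inv_sq norm_alternatingCosSeries_term_le

theorem alternatingCosSeries_add_nat (u : ℝ) (m : ℕ) :
    alternatingCosSeries (u + m) = alternatingCosSeries u := by
  unfold alternatingCosSeries
  congr 1
  ext n
  rw [show 2 * π * n * (u + m) = 2 * π * n * u + (n * m : ℕ) * (2 * π) by push_cast; ring,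
    Real.cos_add_nat_mul_two_pi]

/-- The shift by `1/2` absorbs the signs `(-1)^n` into the Fourier series of `B_2`. -/
theorem alternatingCosSeries_eq_bernoulli {x : ℝ} (hx : x ∈ Icc (0 : ℝ) 1) :
    alternatingCosSeries (x - 1 / 2) = π ^ 2 * (x ^ 2 - x + 1 / 6) := by
  have h := hasSum_one_div_nat_pow_mul_cos one_ne_zero hx
  have e : (Polynomial.map (algebraMap ℚ ℝ) (Polynomial.bernoulli (2 * 1))).eval x =
      x ^ 2 - x + 1 / 6 := by
    simp [Polynomial.bernoulli, Finset.sum_range_succ, bernoulli_two,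
      Polynomial.eval_monomial]
    ring
  rw [e] at h
  unfold alternatingCosSeries
  rw [show π ^ 2 * (x ^ 2 - x + 1 / 6) = (-1 : ℝ) ^ (1 + 1) * (2 * π) ^ (2 * 1) / 2 /
    ((2 * 1).factorial : ℝ) * (x ^ 2 - x + 1 / 6) by
      rw [show Nat.factorial (2 * 1) = 2 from rfl]; push_cast; ring, ← h.tsum_eq]
  congr 1
  ext n
  rw [show 2 * π * n * (x - 1 / 2) = 2 * π * n * x - n * π by ring, Real.cos_sub_nat_mul_pi]
  rw [mul_one, ← mul_assoc, div_mul_eq_mul_div, ← pow_add, ← two_mul, pow_mul]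
  simp

theorem alternatingCosSeries_left {u : ℝ} (h0 : 0 ≤ u) (h1 : u ≤ 1 / 2) :
    alternatingCosSeries u = π ^ 2 * (u ^ 2 - 1 / 12) := by
  have h := alternatingCosSeries_eq_bernoulli (x := u + 1 / 2) ⟨by linarith, by linarith⟩
  rw [add_sub_cancel_right] at h
  rw [h]
  ring

theorem alternatingCosSeries_right {u : ℝ} (h0 : 1 / 2 ≤ u) (h1 : u ≤ 1) :
    alternatingCosSeries u = π ^ 2 * ((u - 1) ^ 2 - 1 / 12) := by
  have h := alternatingCosSeries_eq_bernoulli (x := u - 1 / 2) ⟨by linarith, by linarith⟩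
  have h2 := alternatingCosSeries_add_nat (u - 1 / 2 - 1 / 2) 1
  rw [show u - 1 / 2 - 1 / 2 + ((1 : ℕ) : ℝ) = u by push_cast; ring] at h2
  rw [h2, h]
  ring

theorem hasDerivAt_logPrimitive {z : ℂ} (hz : z ∈ Complex.slitPlane) :
    HasDerivAt logPrimitive (Complex.log z) z := by
  have h := ((hasDerivAt_id z).fun_mul (Complex.hasDerivAt_log hz)).fun_sub (hasDerivAt_id z)
  refine h.congr_deriv ?_
  have := Complex.slitPlane_ne_zero hz
  simp only [id]
  field_simp
  ring

/-- A primitive of `P(v) / (w + v)²` is `-P / (w + v) + P' log (w + v) - P'' g (w + v)` for a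
quadratic polynomial `P`, here `(v - s)² - c`, and `g = logPrimitive`. -/
theorem hasDerivAt_quadratic_primitive {w : ℂ} {v : ℝ} (h : w + v ∈ Complex.slitPlane) (s c : ℂ) :
    HasDerivAt (fun v : ℝ => -(((v : ℂ) - s) ^ 2 - c) / (w + v) +
        2 * ((v : ℂ) - s) * Complex.log (w + v) - 2 * logPrimitive (w + v))
      ((((v : ℂ) - s) ^ 2 - c) / (w + v) ^ 2) v := by
  have hne := Complex.slitPlane_ne_zero h
  have hv : HasDerivAt (fun v : ℝ => (v : ℂ)) 1 v := (hasDerivAt_id v).ofReal_comp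
  have hlin : HasDerivAt (fun v : ℝ => w + (v : ℂ)) 1 v := hv.const_add w
  have hsub : HasDerivAt (fun v : ℝ => (v : ℂ) - s) 1 v := hv.sub_const s
  have hlog : HasDerivAt (fun v : ℝ => Complex.log (w + (v : ℂ))) ((w + v)⁻¹ * 1) v :=
    HasDerivAt.comp (h₂ := Complex.log) v (Complex.hasDerivAt_log h) hlin
  have hprim : HasDerivAt (fun v : ℝ => logPrimitive (w + (v : ℂ)))
      (Complex.log (w + v) * 1) v :=
    HasDerivAt.comp (h₂ := logPrimitive) v (hasDerivAt_logPrimitive h) hlin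
  have htot := ((((hsub.fun_pow 2).sub_const c).fun_neg.fun_div hlin hne).fun_add
    ((hsub.const_mul 2).fun_mul hlog)).fun_sub (hprim.const_mul 2)
  refine htot.congr_deriv ?_
  generalize Complex.log (w + v) = L
  field_simp
  push_cast
  ring

theorem integral_quadratic_div {w : ℂ} (hw : w ≠ 0) (hre : 0 ≤ w.re) {a b : ℝ} (ha : 0 ≤ a)
    (hab : a ≤ b) (s c : ℂ) :
    ∫ v in a..b, (((v : ℂ) - s) ^ 2 - c) / (w + v) ^ 2 =
      (-(((b : ℂ) - s) ^ 2 - c) / (w + b) + 2 * ((b : ℂ) - s) * Complex.log (w + b)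
        - 2 * logPrimitive (w + b)) -
      (-(((a : ℂ) - s) ^ 2 - c) / (w + a) + 2 * ((a : ℂ) - s) * Complex.log (w + a)
        - 2 * logPrimitive (w + a)) := by
  refine intervalIntegral.integral_eq_sub_of_hasDerivAt
    (f := fun v : ℝ => -(((v : ℂ) - s) ^ 2 - c) / (w + v) +
      2 * ((v : ℂ) - s) * Complex.log (w + v) - 2 * logPrimitive (w + v)) (fun v hv => ?_) ?_
  · rw [uIcc_of_le hab] at hv
    exact hasDerivAt_quadratic_primitive (add_ofReal_mem_slitPlane hw hre (ha.trans hv.1)) s c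
  · refine ContinuousOn.intervalIntegrable (ContinuousOn.div (by fun_prop) (by fun_prop) ?_)
    intro v hv
    rw [uIcc_of_le hab] at hv
    exact pow_ne_zero _ (Complex.slitPlane_ne_zero
      (add_ofReal_mem_slitPlane hw hre (ha.trans hv.1)))

theorem continuousOn_alternatingCosSeries_div {w : ℂ} (hw : w ≠ 0) (hre : 0 ≤ w.re) :
    ContinuousOn (fun v : ℝ => (alternatingCosSeries v : ℂ) / (w + v) ^ 2) (Ici 0) := by
  refine ContinuousOn.div
    (Complex.continuous_ofReal.comp continuous_alternatingCosSeries).continuousOn (by fun_prop) ?_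
  intro v hv
  exact pow_ne_zero _ (Complex.slitPlane_ne_zero (add_ofReal_mem_slitPlane hw hre hv))

theorem intervalIntegrable_alternatingCosSeries_div {w : ℂ} (hw : w ≠ 0) (hre : 0 ≤ w.re) {a b : ℝ}
    (ha : 0 ≤ a) (hab : a ≤ b) :
    IntervalIntegrable (fun v : ℝ => (alternatingCosSeries v : ℂ) / (w + v) ^ 2) volume a b := by
  refine ((continuousOn_alternatingCosSeries_div hw hre).mono ?_).intervalIntegrable
  rw [uIcc_of_le hab]
  exact fun v hv => ha.trans hv.1

/-- The integral over one period is a midpoint-rule error up to a telescoping term. -/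
theorem integral_alternatingCosSeries_cell {w : ℂ} (hw : w ≠ 0) (hre : 0 ≤ w.re) :
    ∫ v in (0 : ℝ)..1, (alternatingCosSeries v : ℂ) / (w + v) ^ 2 =
      -(π : ℂ) ^ 2 * (2 * midpointError w + (1 / w - 1 / (w + 1)) / 12) := by
  have h1 : ∫ v in (0 : ℝ)..(1 / 2), (alternatingCosSeries v : ℂ) / (w + v) ^ 2 =
      (π : ℂ) ^ 2 * ∫ v in (0 : ℝ)..(1 / 2), (((v : ℂ) - 0) ^ 2 - 1 / 12) / (w + v) ^ 2 := by
    rw [← intervalIntegral.integral_const_mul]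
    refine intervalIntegral.integral_congr fun v hv => ?_
    rw [uIcc_of_le (by norm_num)] at hv
    simp only [alternatingCosSeries_left hv.1 hv.2]
    push_cast
    ring
  have h2 : ∫ v in (1 / 2 : ℝ)..1, (alternatingCosSeries v : ℂ) / (w + v) ^ 2 =
      (π : ℂ) ^ 2 * ∫ v in (1 / 2 : ℝ)..1, (((v : ℂ) - 1) ^ 2 - 1 / 12) / (w + v) ^ 2 := by
    rw [← intervalIntegral.integral_const_mul]
    refine intervalIntegral.integral_congr fun v hv => ?_
    rw [uIcc_of_le (by norm_num)] at hv
    simp only [alternatingCosSeries_right hv.1 hv.2]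
    push_cast
    ring
  rw [← intervalIntegral.integral_add_adjacent_intervals
    (intervalIntegrable_alternatingCosSeries_div hw hre le_rfl (by norm_num : (0 : ℝ) ≤ 1 / 2))
    (intervalIntegrable_alternatingCosSeries_div hw hre (by norm_num)
      (by norm_num : (1 / 2 : ℝ) ≤ 1)),
    h1, h2, integral_quadratic_div hw hre le_rfl (by norm_num),
    integral_quadratic_div hw hre (by norm_num) (by norm_num), midpointError]
  have hne1 := Complex.slitPlane_ne_zero
    (add_ofReal_mem_slitPlane hw hre (by norm_num : (0 : ℝ) ≤ 1 / 2))
  have hne2 := Complex.slitPlane_ne_zero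
    (add_ofReal_mem_slitPlane hw hre (by norm_num : (0 : ℝ) ≤ 1))
  push_cast at hne1 hne2 ⊢
  rw [add_zero]
  generalize Complex.log (w + 1 / 2) = L
  generalize logPrimitive (w + 1 / 2) = A
  generalize logPrimitive (w + 1) = B
  have h3 : w * 2 + 1 ≠ 0 := by
    intro h
    apply hne1
    linear_combination h / 2
  field_simp
  ring

theorem integrableOn_alternatingCosSeries_div {z : ℂ} (hz : z ≠ 0) (hre : 0 ≤ z.re) :
    IntegrableOn (fun v : ℝ => (alternatingCosSeries v : ℂ) / (z + v) ^ 2) (Ioi 0) := by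
  have hbd : ∀ u, ‖alternatingCosSeries u‖ ≤ ∑' n : ℕ, 1 / (n : ℝ) ^ 2 := fun u =>
    tsum_of_norm_bounded summable_inv_sq.hasSum fun n => norm_alternatingCosSeries_term_le n u
  have h := (integrableOn_div_ofReal_add_pow hz hre 0 (f := fun _ => 1) (by fun_prop)
    (by simp)).bdd_mul (f := fun u => (alternatingCosSeries u : ℂ))
    (Complex.continuous_ofReal.comp continuous_alternatingCosSeries).aestronglyMeasurable
    (Eventually.of_forall fun u => by rw [Complex.norm_real]; exact hbd u)
  refine h.congr (Eventually.of_forall fun u => ?_)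
  simp only [mul_zero, zero_add, mul_one_div, add_comm]

theorem integral_alternatingCosSeries_div_eq {z : ℂ} (hz : z ≠ 0) (hre : 0 ≤ z.re) :
    ∫ v in Ioi (0 : ℝ), (alternatingCosSeries v : ℂ) / (z + v) ^ 2 =
      -2 * (π : ℂ) ^ 2 * (Rhat 1 z + 1 / (24 * z)) := by
  have h1 := intervalIntegral_tendsto_integral_Ioi 0 (integrableOn_alternatingCosSeries_div hz hre)
    (tendsto_natCast_atTop_atTop (R := ℝ))
  have hcell : ∀ m : ℕ,
      ∫ v in (m : ℝ)..((m + 1 : ℕ) : ℝ), (alternatingCosSeries v : ℂ) / (z + v) ^ 2 =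
      -(π : ℂ) ^ 2 * (2 * midpointError (z + m) +
        (1 / (z + m) - 1 / (z + (m + 1 : ℕ))) / 12) := by
    intro m
    have hm : z + m ≠ 0 := by
      have := Complex.slitPlane_ne_zero
        (add_ofReal_mem_slitPlane hz hre (by positivity : (0 : ℝ) ≤ m))
      exact_mod_cast this
    have hmre : 0 ≤ (z + m).re := by
      simp only [Complex.add_re, Complex.natCast_re]
      positivity
    have h := integral_alternatingCosSeries_cell hm hmre
    have hshift := intervalIntegral.integral_comp_add_right (a := 0) (b := 1)
      (fun v : ℝ => (alternatingCosSeries v : ℂ) / (z + v) ^ 2) (m : ℝ)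
    rw [zero_add, add_comm (1 : ℝ)] at hshift
    push_cast
    rw [← add_assoc, ← h, ← hshift]
    refine intervalIntegral.integral_congr fun v _ => ?_
    simp only [alternatingCosSeries_add_nat]
    push_cast
    rw [add_assoc, add_comm (m : ℂ)]
  have h2 : ∀ n : ℕ, ∫ v in (0 : ℝ)..n, (alternatingCosSeries v : ℂ) / (z + v) ^ 2 =
      -(π : ℂ) ^ 2 * (2 * (∑ m ∈ Finset.range n, midpointError (z + m)) +
        (1 / z - 1 / (z + n)) / 12) := by
    intro n
    have hs := intervalIntegral.sum_integral_adjacent_intervals (n := n) (a := fun m : ℕ => (m : ℝ))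
      (f := fun v : ℝ => (alternatingCosSeries v : ℂ) / (z + v) ^ 2) (μ := volume)
      (fun m _ => intervalIntegrable_alternatingCosSeries_div hz hre (by positivity)
        (by push_cast; linarith))
    simp only [Nat.cast_zero] at hs
    rw [← hs, Finset.sum_congr rfl fun m _ => hcell m, ← Finset.mul_sum, Finset.sum_add_distrib,
      ← Finset.mul_sum, ← Finset.sum_div, Finset.sum_range_sub' (fun m : ℕ => 1 / (z + (m : ℂ)))]
    simp
  have hinv : Tendsto (fun n : ℕ => 1 / (z + (n : ℂ))) atTop (𝓝 0) := by
    have h := (tendsto_bounded_div_ofReal_add_pow (z := z) (f := fun _ => 1) hre (by simp) 0).comp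
      (tendsto_natCast_atTop_atTop (R := ℝ))
    simpa [Function.comp_def, add_comm] using h
  have h3 := (((tendsto_sum_midpointError hz hre).const_mul 2).add
    ((hinv.const_sub (1 / z)).div_const 12)).const_mul (-(π : ℂ) ^ 2)
  refine tendsto_nhds_unique (h1.congr fun n => h2 n) (h3.trans_eq ?_)
  congr 1
  field_simp
  ring

/-! ### Zeta values and the series for the remainder -/

theorem eta_pos {k : ℕ} (hk : 1 ≤ k) : 0 < eta k := by
  unfold eta
  have : (2 : ℝ) ^ (1 - 2 * (k : ℤ)) < 1 := zpow_lt_one_of_neg₀ (by norm_num) (by omega)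
  exact one_div_pos.mpr (by linarith)

theorem two_zpow_eq (j : ℕ) :
    (2 : ℝ) ^ (1 - 2 * ((j + 1 : ℕ) : ℤ)) = 1 / 2 ^ (2 * j + 1) := by
  rw [show 1 - 2 * ((j + 1 : ℕ) : ℤ) = -((2 * j + 1 : ℕ) : ℤ) by push_cast; ring, zpow_neg,
    zpow_natCast, one_div]

/-- The sum `∑_{n ≥ 1} (2 π n)^{-2(j+1)}`; the term at `n = 0` is zero, as a division by zero. -/
noncomputable def zetaWeight (j : ℕ) : ℝ := ∑' n : ℕ, 1 / (2 * π * n) ^ (2 * (j + 1))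

theorem hasSum_zetaWeight (j : ℕ) :
    HasSum (fun n : ℕ => 1 / (2 * π * n) ^ (2 * (j + 1))) (zetaWeight j) := by
  have h : Summable fun n : ℕ => 1 / (n : ℝ) ^ (2 * (j + 1)) :=
    Real.summable_one_div_nat_pow.mpr (by omega)
  have h2 : Summable fun n : ℕ => 1 / (2 * π * n) ^ (2 * (j + 1)) := by
    refine (h.mul_left (1 / (2 * π) ^ (2 * (j + 1)))).congr fun n => ?_
    rw [mul_pow _ (n : ℝ), one_div_mul_one_div]
  exact h2.hasSum

theorem zetaWeight_pos (j : ℕ) : 0 < zetaWeight j := by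
  refine (hasSum_zetaWeight j).summable.tsum_pos (fun n => by positivity) 1 ?_
  have := pi_pos
  push_cast
  positivity

/-- The alternating sum, by comparison with its even part; this is where `η_k` enters. -/
theorem hasSum_alternating_zetaWeight (j : ℕ) :
    HasSum (fun n : ℕ => (-1) ^ n / (2 * π * n) ^ (2 * (j + 1)))
      (-(zetaWeight j / eta (j + 1))) := by
  have hZ := hasSum_zetaWeight j
  have heven : HasSum (fun n : ℕ => (1 + (-1) ^ n) / (2 * π * n) ^ (2 * (j + 1)))
      (1 / 2 ^ (2 * j + 1) * zetaWeight j) := by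
    have hinj : Function.Injective fun m : ℕ => 2 * m := fun a b h => by simpa using h
    rw [← hinj.hasSum_iff]
    · refine (hZ.mul_left (1 / 2 ^ (2 * j + 1))).congr_fun ?_
      intro m
      simp only [Function.comp_apply, pow_mul, neg_one_sq, one_pow]
      rw [← pow_mul, ← pow_mul, show 2 * π * ((2 * m : ℕ) : ℝ) = 2 * (2 * π * m) by push_cast; ring,
        mul_pow 2 (2 * π * (m : ℝ)), show 2 * (j + 1) = 2 * j + 1 + 1 by ring, pow_succ (2 : ℝ)]
      rcases Nat.eq_zero_or_pos m with rfl | hm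
      · simp
      · have : (0 : ℝ) < m := by exact_mod_cast hm
        field_simp
        norm_num
    · intro n hn
      have hodd : Odd n := by
        rw [← Nat.not_even_iff_odd]
        rintro ⟨m, rfl⟩
        exact hn ⟨m, by simp only; ring⟩
      simp [hodd.neg_one_pow]
  have h := heven.sub hZ
  have e : 1 / 2 ^ (2 * j + 1) * zetaWeight j - zetaWeight j =
      -(zetaWeight j / eta (j + 1)) := by
    rw [eta, two_zpow_eq]
    rw [div_div_eq_mul_div]
    ring
  rw [e] at h
  refine h.congr_fun fun n => ?_
  ring

theorem T_succ_eq (j : ℕ) {z : ℂ} :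
    T (j + 1) z =
      (-1) ^ j * 2 * ((2 * j).factorial : ℂ) * (zetaWeight j : ℂ) / z ^ (2 * j + 1) := by
  have hZ := (hasSum_zeta_nat (k := j + 1) (by omega)).mul_left (1 / (2 * π) ^ (2 * (j + 1)))
  have hS : zetaWeight j = 1 / (2 * π) ^ (2 * (j + 1)) *
      ((-1) ^ (j + 1 + 1) * 2 ^ (2 * (j + 1) - 1) * π ^ (2 * (j + 1)) *
        bernoulli (2 * (j + 1)) / ((2 * (j + 1)).factorial : ℝ)) := by
    refine (hasSum_zetaWeight j).unique (hZ.congr_fun fun n => ?_)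
    rw [mul_pow _ (n : ℝ), one_div_mul_one_div]
  have hS2 : (bernoulli (2 * (j + 1)) : ℝ) =
      (-1) ^ j * 2 * ((2 * (j + 1)).factorial : ℝ) * zetaWeight j := by
    rw [hS, show 2 * (j + 1) - 1 = 2 * j + 1 by omega, mul_pow 2 π,
      show 2 * (j + 1) = 2 * j + 1 + 1 by ring, pow_succ (2 : ℝ)]
    have h1 : ((-1 : ℝ) ^ j) * (-1) ^ (j + 1 + 1) = 1 := by
      rw [← pow_add, show j + (j + 1 + 1) = 2 * (j + 1) by ring, pow_mul]
      simp
    have h2 := pi_pos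
    have h3 : ((2 * j + 1 + 1).factorial : ℝ) ≠ 0 := by positivity
    field_simp
    linear_combination -(bernoulli (2 * j + 1 + 1) : ℝ) * h1
  have hS3 : (bernoulli (2 * (j + 1)) : ℂ) =
      (-1) ^ j * 2 * ((2 * (j + 1)).factorial : ℂ) * (zetaWeight j : ℂ) := by
    exact_mod_cast congrArg (fun x : ℝ => (x : ℂ)) hS2
  rw [T, hS3, show 2 * (j + 1) - 1 = 2 * j + 1 by omega,
    show 2 * (j + 1) = 2 * j + 1 + 1 by ring, Nat.factorial_succ, Nat.factorial_succ]
  have h1 : (j : ℂ) + 1 ≠ 0 := by exact_mod_cast Nat.succ_ne_zero j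
  have h2 : (2 * j + 1 : ℂ) ≠ 0 := by exact_mod_cast Nat.succ_ne_zero (2 * j)
  push_cast
  have h3 : 2 * ((j : ℂ) + 1) - 1 = 2 * j + 1 := by ring
  rw [h3]
  have h4 : (2 * j + 1 + 1 : ℂ) = 2 * (j + 1) := by ring
  rw [h4, ← div_div]
  congr 1
  field_simp

theorem That_succ_eq (j : ℕ) {z : ℂ} (hz : z ≠ 0) :
    That (j + 1) z = (-1) ^ j * 2 * ((2 * j).factorial : ℂ) *
      ((-(zetaWeight j / eta (j + 1)) : ℝ) : ℂ) / z ^ (2 * j + 1) := by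
  rw [That, T_succ_eq, T_succ_eq, eta, two_zpow_eq, mul_pow]
  push_cast
  have : (2 : ℂ) ^ (2 * j + 1) ≠ 0 := pow_ne_zero _ two_ne_zero
  rw [div_div_eq_mul_div]
  field_simp
  ring

theorem Rhat_succ {k : ℕ} (hk : 1 ≤ k) (z : ℂ) : Rhat (k + 1) z = Rhat k z - That k z := by
  rw [Rhat, Rhat, Finset.sum_Ico_succ_top hk]
  ring

theorem That_one (z : ℂ) : That 1 z = -(1 / (24 * z)) := by
  rw [That, T, T, show 2 * 1 = 2 from rfl, bernoulli_two]
  rcases eq_or_ne z 0 with rfl | hz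
  · simp
  · push_cast
    field_simp
    norm_num

/-- Termwise integration of the Fourier series. -/
theorem hasSum_integral_alternatingCosSeries {z : ℂ} (hz : z ≠ 0) (hre : 0 ≤ z.re) :
    HasSum (fun n : ℕ => (-1 : ℂ) ^ n / (n : ℂ) ^ 2 * cosIntegral (2 * π * n) 0 z)
      (∫ v in Ioi (0 : ℝ), (alternatingCosSeries v : ℂ) / (z + v) ^ 2) := by
  have hz' := norm_pos_iff.mpr hz
  have hbound : ∀ (n : ℕ), ∀ u ∈ Ioi (0 : ℝ), ‖(-1 : ℂ) ^ n / (n : ℂ) ^ 2 *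
      ((Real.cos (2 * π * n * u) : ℂ) / ((u : ℂ) + z) ^ (2 * 0 + 2))‖ ≤
      1 / (n : ℝ) ^ 2 * ((u ^ 2 + ‖z‖ ^ 2) ^ (0 + 1))⁻¹ := by
    intro n u hu
    rw [norm_mul]
    gcongr
    · simp
    · exact norm_div_ofReal_add_pow_le hz hre 0 (le_of_lt hu) (norm_ofReal_cos_le_one _)
  have hint : ∀ n : ℕ, IntegrableOn (fun u : ℝ => (-1 : ℂ) ^ n / (n : ℂ) ^ 2 *
      ((Real.cos (2 * π * n * u) : ℂ) / ((u : ℂ) + z) ^ (2 * 0 + 2))) (Ioi 0) := fun n =>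
    (integrableOn_cos_div hz hre (2 * π * n) 0).const_mul _
  have hsum : Summable fun n : ℕ => ∫ u in Ioi (0 : ℝ), ‖(-1 : ℂ) ^ n / (n : ℂ) ^ 2 *
      ((Real.cos (2 * π * n * u) : ℂ) / ((u : ℂ) + z) ^ (2 * 0 + 2))‖ := by
    refine Summable.of_nonneg_of_le (fun n => integral_nonneg fun u => norm_nonneg _) (fun n => ?_)
      (summable_inv_sq.mul_right (∫ u in Ioi (0 : ℝ), ((u ^ 2 + ‖z‖ ^ 2) ^ (0 + 1))⁻¹))
    rw [← integral_const_mul]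
    exact setIntegral_mono_on (hint n).norm
      ((integrableOn_inv_sq_add_sq_pow hz' 0).const_mul _) measurableSet_Ioi (hbound n)
  have h := hasSum_integral_of_summable_integral_norm hint hsum
  simp only [integral_const_mul] at h
  have e : (fun v : ℝ => (alternatingCosSeries v : ℂ) / (z + v) ^ 2) = fun u : ℝ =>
      ∑' n : ℕ, (-1 : ℂ) ^ n / (n : ℂ) ^ 2 *
        ((Real.cos (2 * π * n * u) : ℂ) / ((u : ℂ) + z) ^ (2 * 0 + 2)) := by
    ext u
    rw [alternatingCosSeries, Complex.ofReal_tsum, ← tsum_div_const]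
    congr 1
    ext n
    push_cast
    rw [add_comm z]
    ring
  rw [e]
  exact h

/-- The exact series for `R̂_{k+1}(z)`, with `k = j + 1`. -/
theorem hasSum_Rhat {z : ℂ} (hz : z ≠ 0) (hre : 0 ≤ z.re) (j : ℕ) :
    HasSum (fun n : ℕ => (((-1) ^ n / (2 * π * n) ^ (2 * (j + 1)) : ℝ) : ℂ) *
      cosIntegral (2 * π * n) j z)
      ((-1) ^ (j + 1) * Rhat (j + 2) z / (2 * ((2 * j + 1).factorial : ℂ))) := by
  have hpi : (π : ℂ) ≠ 0 := by exact_mod_cast pi_pos.ne'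
  induction j with
  | zero =>
    have h := (hasSum_integral_alternatingCosSeries hz hre).mul_left (1 / (2 * π : ℂ) ^ 2)
    have e : 1 / (2 * π : ℂ) ^ 2 *
        (∫ v in Ioi (0 : ℝ), (alternatingCosSeries v : ℂ) / (z + v) ^ 2) =
        (-1) ^ (0 + 1) * Rhat (0 + 2) z / (2 * ((2 * 0 + 1).factorial : ℂ)) := by
      rw [integral_alternatingCosSeries_div_eq hz hre, Rhat_succ le_rfl, That_one]
      simp only [mul_zero, zero_add, Nat.factorial_one]
      push_cast
      field_simp
      ring
    rw [e] at h
    refine h.congr_fun fun n => ?_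
    push_cast
    rw [mul_pow _ (n : ℂ), ← mul_assoc, div_mul_div_comm, one_mul]
  | succ j ih =>
    have hA := Complex.hasSum_ofReal.mpr (hasSum_alternating_zetaWeight (j + 1))
    have h := ((hA.mul_left ((2 * j + 2) / z ^ (2 * j + 3))).sub ih).div_const
      ((2 * j + 2) * (2 * j + 3) : ℂ)
    have h2 : (2 * j + 2 : ℂ) ≠ 0 := by exact_mod_cast Nat.succ_ne_zero (2 * j + 1)
    have h3 : (2 * j + 3 : ℂ) ≠ 0 := by exact_mod_cast Nat.succ_ne_zero (2 * j + 2)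
    have hval : ((2 * j + 2) / z ^ (2 * j + 3) *
        ((-(zetaWeight (j + 1) / eta (j + 1 + 1)) : ℝ) : ℂ) -
        (-1) ^ (j + 1) * Rhat (j + 2) z / (2 * ((2 * j + 1).factorial : ℂ))) /
        ((2 * j + 2) * (2 * j + 3) : ℂ) =
        (-1) ^ (j + 1 + 1) * Rhat (j + 1 + 2) z / (2 * ((2 * (j + 1) + 1).factorial : ℂ)) := by
      rw [Rhat_succ (by omega : 1 ≤ j + 2), That_succ_eq (j + 1) hz,
        show 2 * (j + 1) + 1 = 2 * j + 1 + 1 + 1 by ring, show 2 * (j + 1) = 2 * j + 1 + 1 by ring,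
        Nat.factorial_succ (2 * j + 1 + 1), Nat.factorial_succ (2 * j + 1)]
      generalize ((-(zetaWeight (j + 1) / eta (j + 1 + 1)) : ℝ) : ℂ) = A
      push_cast
      generalize Rhat (j + 2) z = R
      have hf : ((2 * j + 1).factorial : ℂ) ≠ 0 := by exact_mod_cast Nat.factorial_ne_zero _
      generalize ((2 * j + 1).factorial : ℂ) = F at hf ⊢
      rw [show (2 * j + 1 + 1 : ℂ) = 2 * j + 2 by ring,
        show (2 * j + 2 + 1 : ℂ) = 2 * j + 3 by ring, show 2 * j + 1 + 1 + 1 = 2 * j + 3 by ring]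
      have hs : ((-1 : ℂ) ^ j) * (-1) ^ j = 1 := by rw [← mul_pow]; simp
      simp only [pow_succ (-1 : ℂ)]
      field_simp
      linear_combination -(2 * A * F * (2 * j + 2)) * hs
    rw [hval] at h
    refine h.congr_fun fun n => ?_
    -- at `n = 0` the weight vanishes, while `cosIntegral_eq` needs `ω ≠ 0`
    rcases Nat.eq_zero_or_pos n with rfl | hn
    · simp
    · have hn' : (0 : ℝ) < n := by exact_mod_cast hn
      have hω : 2 * π * n ≠ 0 := by have := pi_pos; positivity
      have hωc : (2 * π * n : ℂ) ≠ 0 := by exact_mod_cast hω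
      rw [cosIntegral_eq hz hre hω j]
      push_cast
      generalize (2 * π * n : ℂ) = ω at hωc ⊢
      rw [show 2 * (j + 1 + 1) = 2 * (j + 1) + 2 by ring, pow_add]
      field_simp
      ring

/-- The first inequality: the series for `R̂_{k+1}` is compared term by term with the zeta sum
in `T̂_k`, strictly at `n = 1`. -/
theorem norm_Rhat_div_That_lt {k : ℕ} (hk : 1 ≤ k) {z : ℂ} (hz : z ≠ 0) (hre : 0 ≤ z.re)
    (hkz : (k : ℝ) ≤ ‖z‖) :
    ‖Rhat (k + 1) z / That k z‖ < eta k * ((k / ‖z‖) ^ 2 / (π ^ 2 - 1)) := by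
  obtain ⟨j, rfl⟩ : ∃ j, k = j + 1 := ⟨k - 1, by omega⟩
  have hz' := norm_pos_iff.mpr hz
  have hη := eta_pos hk
  have hS := zetaWeight_pos j
  obtain ⟨Q, hQ⟩ : ∃ Q : ℝ, Q = (((j + 1 : ℕ) : ℝ) / ‖z‖) ^ 2 / (π ^ 2 - 1) := ⟨_, rfl⟩
  rw [← hQ]
  have hterm : ∀ n : ℕ, 1 ≤ n →
      ‖cosIntegral (2 * π * n) j z‖ < Q / ((2 * j + 1) * ‖z‖ ^ (2 * j + 1)) := by
    intro n hn
    have hn' : (1 : ℝ) ≤ n := by exact_mod_cast hn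
    have hω : 2 * π ≤ 2 * π * n := le_mul_of_one_le_right (by positivity) hn'
    have h := cosIntegral_lt hk hz hre hkz hω
    rw [← hQ, show 2 * (j + 1) - 1 = 2 * j + 1 by omega, Nat.add_sub_cancel] at h
    rw [lt_div_iff₀ (by positivity)]
    push_cast at h
    linarith
  obtain ⟨C, hC⟩ : ∃ C : ℝ, C = Q / ((2 * j + 1) * ‖z‖ ^ (2 * j + 1)) := ⟨_, rfl⟩
  rw [← hC] at hterm
  have hR := hasSum_Rhat hz hre j
  have hmaj := (hasSum_zetaWeight j).mul_right C
  have hle : ∀ n : ℕ, ‖(((-1) ^ n / (2 * π * n) ^ (2 * (j + 1)) : ℝ) : ℂ) *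
      cosIntegral (2 * π * n) j z‖ ≤ 1 / (2 * π * n) ^ (2 * (j + 1)) *
        ‖cosIntegral (2 * π * n) j z‖ := by
    intro n
    rw [norm_mul, Complex.norm_real, norm_div, norm_pow, norm_neg, norm_one, one_pow,
      norm_of_nonneg (by positivity : 0 ≤ (2 * π * (n : ℝ)) ^ (2 * (j + 1)))]
  have hle2 : ∀ n : ℕ, 1 / (2 * π * n) ^ (2 * (j + 1)) * ‖cosIntegral (2 * π * n) j z‖ ≤
      1 / (2 * π * n) ^ (2 * (j + 1)) * C := by
    intro n
    rcases Nat.eq_zero_or_pos n with rfl | hn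
    · simp
    · gcongr
      exact (hterm n hn).le
  have hsummable : Summable fun n : ℕ =>
      1 / (2 * π * n) ^ (2 * (j + 1)) * ‖cosIntegral (2 * π * n) j z‖ :=
    Summable.of_nonneg_of_le (fun n => by positivity) hle2 hmaj.summable
  have hsumlt : ‖(-1) ^ (j + 1) * Rhat (j + 2) z / (2 * ((2 * j + 1).factorial : ℂ))‖ <
      zetaWeight j * C := by
    rw [← hR.tsum_eq, ← hmaj.tsum_eq]
    refine (tsum_of_norm_bounded hsummable.hasSum hle).trans_lt ?_
    refine hsummable.tsum_lt_tsum (i := 1) hle2 ?_ hmaj.summable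
    have := pi_pos
    have := hterm 1 le_rfl
    push_cast at this ⊢
    gcongr
  rw [norm_div, norm_mul, norm_pow, norm_neg, norm_one, one_pow, one_mul, norm_mul,
    Complex.norm_natCast, Complex.norm_ofNat, div_lt_iff₀ (by positivity)] at hsumlt
  have hThat : ‖That (j + 1) z‖ =
      2 * ((2 * j).factorial : ℝ) * (zetaWeight j / eta (j + 1)) / ‖z‖ ^ (2 * j + 1) := by
    rw [That_succ_eq j hz]
    simp only [norm_div, norm_mul, norm_pow, norm_neg, norm_one, one_pow, one_mul,
      Complex.norm_natCast, Complex.norm_ofNat, Complex.norm_real]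
    rw [norm_of_nonneg hS.le, norm_of_nonneg hη.le]
  rw [norm_div, div_lt_iff₀ (by rw [hThat]; positivity), hThat]
  refine hsumlt.trans_eq ?_
  rw [hC, Nat.factorial_succ]
  push_cast
  field_simp

end StirlingHalf

theorem mainTheorem7 (k : ℕ) (hk : 1 ≤ k) (z : ℂ) (hz : z ≠ 0) (hre : 0 ≤ z.re)
    (hkz : (k : ℝ) ≤ ‖z‖) :
    ‖StirlingHalf.Rhat (k + 1) z / StirlingHalf.That k z‖
        < StirlingHalf.eta k * (((k : ℝ) / ‖z‖) ^ 2 / (Real.pi ^ 2 - 1)) ∧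
      ‖StirlingHalf.Rhat k z / StirlingHalf.That k z‖
        < 1 + StirlingHalf.eta k * (((k : ℝ) / ‖z‖) ^ 2 / (Real.pi ^ 2 - 1)) := by
  have h := StirlingHalf.norm_Rhat_div_That_lt hk hz hre hkz
  refine ⟨h, ?_⟩
  have hsplit : StirlingHalf.Rhat k z / StirlingHalf.That k z =
      StirlingHalf.That k z / StirlingHalf.That k z +
        StirlingHalf.Rhat (k + 1) z / StirlingHalf.That k z := by
    rw [StirlingHalf.Rhat_succ hk, ← add_div]
    congr 1
    ring
  rw [hsplit]
  refine (norm_add_le _ _).trans_lt (add_lt_add_of_le_of_lt ?_ h)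
  rw [norm_div]
  exact div_self_le_one _
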